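/- For real $\alpha,\beta$ and $\gamma\in(0,\frac{\pi}{2})$ let $$P_{\alpha,\beta,\gamma}(\varphi)=\varphi^2+4\varphi\cos\alpha\cos\beta+4\,\frac{(\cos^2\alpha-\cos^2\gamma)(\cos^2\beta-\cos^2\gamma)}{\sin^2\gamma},$$ and let $P_{\alpha,\beta,\frac{\pi}{2}}(\varphi)=\varphi+2\cos\alpha\cos\beta$. Let $a,b$ be coprime positive integers with $a$ odd, let $c$ be a positive integer, and let $\alpha=\frac{i\pi}{a}$, $\beta=\frac{j\pi}{b}$, $\gamma_1=\frac{k_1\pi}{c}$, $\gamma_2=\frac{k_2\pi}{c}$ with integers $1\le i\le\frac{a-1}{2}$, $1\le j\le b-1$, $1\le k_1,k_2\le\frac{c}{2}$ and $\gamma_1\ne\gamma_2$. Then $P_{\alpha,\beta,\gamma_1}$ and $P_{\alpha,\beta,\gamma_2}$ have a common (complex) root if and only if * either the two polynomials are equal, or $\beta=\frac{\pi}{2}$ and $\{\gamma_1,\gamma_2\}=\{\frac{\pi}{2},\alpha\}$ (in which case they are $\varphi$ and $\varphi^2$), and * up to exchanging $\gamma_1$ and $\gamma_2$, one of the following cases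 occurs: 1. $\sin\alpha=\sin\gamma_1$ and $\sin\beta=\sin\gamma_2$; 2. $\beta\in\{\frac{\pi}{6},\frac{5\pi}{6}\}$, $\gamma_1=\frac{\alpha}{2}$ and $\gamma_2=\frac{\pi}{2}-\frac{\alpha}{2}$. In case 1 the common roots are exactly $\varphi=0$ and $\varphi=-4\cos\alpha\cos\beta$. In case 2 the common roots are exactly $\varphi=-2\cos(\alpha\pm\beta)$; for $\beta=\frac{\pi}{6}$ these are $-2\cos(\alpha\pm\frac{\pi}{6})$. -/

import Mathlib

open scoped Polynomial

/-- The polynomial `P_{α,β,γ}` in the variable `φ`: of degree one when `γ = π/2`,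
of degree two otherwise. -/
noncomputable def factorPoly (α β γ : ℝ) : ℝ[X] :=
  open Classical in
  if γ = Real.pi / 2 then
    Polynomial.X + Polynomial.C (2 * Real.cos α * Real.cos β)
  else
    Polynomial.X ^ 2 + Polynomial.C (4 * Real.cos α * Real.cos β) * Polynomial.X
      + Polynomial.C (4 * ((Real.cos α ^ 2 - Real.cos γ ^ 2) * (Real.cos β ^ 2 - Real.cos γ ^ 2))
          / Real.sin γ ^ 2)

/-- `φ` is a common (complex) root of the real polynomials `P` and `Q`. -/
def IsCommonRoot (P Q : ℝ[X]) (φ : ℂ) : Prop :=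
  Polynomial.aeval φ P = 0 ∧ Polynomial.aeval φ Q = 0

/-- First case: `sin α = sin γ₁` and `sin β = sin γ₂`, up to exchanging `γ₁` and `γ₂`. -/
def SineCase (α β γ₁ γ₂ : ℝ) : Prop :=
  (Real.sin α = Real.sin γ₁ ∧ Real.sin β = Real.sin γ₂) ∨
  (Real.sin α = Real.sin γ₂ ∧ Real.sin β = Real.sin γ₁)

/-- Second case: `β` is `π/6` or `5π/6`, and `γ₁ = α/2`, `γ₂ = π/2 - α/2`,
up to exchanging `γ₁` and `γ₂`. -/
def SixthCase (α β γ₁ γ₂ : ℝ) : Prop :=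
  (β = Real.pi / 6 ∨ β = 5 * Real.pi / 6) ∧
  ((γ₁ = α / 2 ∧ γ₂ = Real.pi / 2 - α / 2) ∨
   (γ₂ = α / 2 ∧ γ₁ = Real.pi / 2 - α / 2))

/-! Put s = sin γ and r = sin α sin β. The linear coefficient of the quadratic is independent of γ,
and its constant term is 4(s² + (r/s)² − sin²α − sin²β). Hence a common root for γ₁ ≠ γ₂ forces sin
γ₁ sin γ₂ = sin α sin β. The value γ = π/2 fits in, because the square of the linear polynomial is
the quadratic formula at s = 1.

With x = e^{iα}, y = e^{iβ}, u = e^{i(γ₁+γ₂)}, v = e^{i(γ₁−γ₂)}, the sine identity is a vanishing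
sum of eight roots of unity: x Y − x⁻¹ Y − (u + u⁻¹) + (v + v⁻¹) = 0, where Y = y − y⁻¹. Let p be a
prime dividing the order of x²; it is odd and prime to b, so y has trivial p-part. When the terms
are collected by their p-parts, Galois conjugation makes the coefficients constant on cosets of the
p-th roots of unity (`sum_ite_eq_of_pow_eq`). Only the p-parts of x, u, v and their inverses can
carry a coefficient, in general too few to fill the coset of the p-part X of x. So the coefficient
at X vanishes and a shorter relation splits off. For p = 3 a coset can be filled: if X³ ≠ 1 this is
the sextile relation, and if X³ = 1 Kronecker's theorem excludes it
(`hasShortRelation_or_hasSextileRelation`).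

Plane geometry finishes: x Y = u' − v' and the sextile relation give the sine case, x Y = −v' gives
the case β = π/6 or 5π/6, and x Y = u' is impossible. -/

/-! ### Galois conjugation and Kronecker's theorem for roots of unity -/

/-- An integral linear relation between `N`-th roots of unity is preserved by the Galois
conjugation `τ ↦ τ ^ k`, for `k` coprime to `N`. -/
theorem sum_pow_eq_zero_of_coprime {ι : Type*} (s : Finset ι) {N k : ℕ} (hN : 0 < N)
    (hk : Nat.Coprime k N) (m : ι → ℤ) (τ : ι → ℂ) (hτ : ∀ i, τ i ^ N = 1)
    (h : ∑ i ∈ s, (m i : ℂ) * τ i = 0) : ∑ i ∈ s, (m i : ℂ) * τ i ^ k = 0 := by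
  have hζ := Complex.isPrimitiveRoot_exp N hN.ne'
  set ζ := Complex.exp (2 * Real.pi * Complex.I / N) with hζdef
  have : NeZero N := ⟨hN.ne'⟩
  choose e _ he using fun i => hζ.eq_pow_of_pow_eq_one (hτ i)
  -- The relation is a polynomial identity at ζ, and ζ and ζ ^ k share their minimal polynomial.
  let f : ℤ[X] := ∑ i ∈ s, Polynomial.C (m i) * Polynomial.X ^ e i
  have hf : ∀ z : ℂ, Polynomial.aeval z f = ∑ i ∈ s, (m i : ℂ) * z ^ e i := by
    intro z
    simp [f, map_sum]
  have h0 : Polynomial.aeval ζ f = 0 := by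
    rw [hf, ← h]
    exact Finset.sum_congr rfl fun i _ => by rw [he]
  have hdvd : minpoly ℤ ζ ∣ f := minpoly.isIntegrallyClosed_dvd (hζ.isIntegral hN) h0
  rw [hζ.minpoly_eq_pow_coprime hk] at hdvd
  have h1 : Polynomial.aeval (ζ ^ k) f = 0 := by
    obtain ⟨q, hq⟩ := hdvd
    rw [hq, map_mul, minpoly.aeval, zero_mul]
  rw [hf] at h1
  rw [← h1]
  refine Finset.sum_congr rfl fun i _ => ?_
  rw [← he i, ← pow_mul, ← pow_mul, mul_comm k]

/-- The geometric sum over the powers of an `n`-th root of unity. -/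
theorem sum_range_pow_of_pow_eq_one {n : ℕ} {z : ℂ} (hz : z ^ n = 1) :
    ∑ t ∈ Finset.range n, z ^ t = if z = 1 then (n : ℂ) else 0 := by
  split_ifs with h
  · simp [h]
  · rw [geom_sum_eq h, hz, sub_self, zero_div]

/-- In an integral linear relation between roots of unity, collect the terms by their `p`-part
`g i`.  The resulting coefficients agree on `p`-parts which differ by a `p`-th root of unity. -/
theorem sum_ite_eq_of_pow_eq {ι : Type*} (s : Finset ι) {p n M : ℕ} (hp : p.Prime)
    (hM : 0 < M) (hpM : ¬ p ∣ M) (m : ι → ℤ) (w g : ι → ℂ)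
    (hw : ∀ i, w i ^ M = 1) (hg : ∀ i, g i ^ p ^ n = 1)
    (h : ∑ i ∈ s, (m i : ℂ) * (w i * g i) = 0) {h₁ h₂ : ℂ} (hh₁ : h₁ ^ p ^ n = 1)
    (hh₂ : h₂ ^ p ^ n = 1) (h₁₂ : h₁ ^ p = h₂ ^ p) :
    ∑ i ∈ s, (if g i = h₁ then (m i : ℂ) * w i else 0) =
      ∑ i ∈ s, (if g i = h₂ then (m i : ℂ) * w i else 0) := by
  have hq : 0 < p ^ n := pow_pos hp.pos n
  have hcop : Nat.Coprime M (p ^ n) :=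
    (Nat.Coprime.pow_left n ((Nat.Prime.coprime_iff_not_dvd hp).2 hpM)).symm
  have hF : ∀ t, ¬ p ∣ t → ∑ i ∈ s, (m i : ℂ) * (w i * g i ^ t) = 0 := by
    intro t ht
    -- The conjugation τ ↦ τ ^ k fixes every `w i` and raises every `g i` to the power t.
    obtain ⟨k, hk1, hk2⟩ := Nat.chineseRemainder hcop 1 t
    have hkM : Nat.Coprime k M := by
      have := hk1.gcd_eq
      rwa [Nat.gcd_one_left] at this
    have hkp : Nat.Coprime k (p ^ n) := by
      have := hk2.gcd_eq
      unfold Nat.Coprime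
      rw [this]
      exact (Nat.Coprime.pow_left n ((Nat.Prime.coprime_iff_not_dvd hp).2 ht)).symm
    have := sum_pow_eq_zero_of_coprime s (Nat.mul_pos hM hq) (hkM.mul_right hkp) m
      (fun i => w i * g i)
      (fun i => by rw [mul_pow, pow_mul, hw, one_pow, mul_comm M, pow_mul, hg, one_pow, one_mul]) h
    rw [← this]
    refine Finset.sum_congr rfl fun i _ => ?_
    have h1 : w i ^ k = w i := by
      have := pow_eq_pow_of_modEq hk1 (hw i)
      rwa [pow_one] at this
    have h2 : g i ^ k = g i ^ t := pow_eq_pow_of_modEq hk2 (hg i)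
    rw [mul_pow, h1, h2]
  have hne : ∀ z : ℂ, z ^ p ^ n = 1 → z ≠ 0 := by
    rintro z hz rfl
    rw [zero_pow hq.ne'] at hz
    exact zero_ne_one hz
  -- Fourier inversion on the group of p ^ n-th roots of unity isolates the terms with `g i = z`.
  have key : ∀ z : ℂ, z ^ p ^ n = 1 →
      ∑ t ∈ Finset.range (p ^ n), (∑ i ∈ s, (m i : ℂ) * (w i * g i ^ t)) * z⁻¹ ^ t =
      (p ^ n : ℕ) * ∑ i ∈ s, (if g i = z then (m i : ℂ) * w i else 0) := by
    intro z hz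
    simp_rw [Finset.sum_mul]
    rw [Finset.sum_comm, Finset.mul_sum]
    refine Finset.sum_congr rfl fun i _ => ?_
    have h1 : ∀ t, (m i : ℂ) * (w i * g i ^ t) * z⁻¹ ^ t = (m i : ℂ) * w i * (g i * z⁻¹) ^ t := by
      intro t
      rw [mul_pow]; ring
    simp_rw [h1]
    rw [← Finset.mul_sum, sum_range_pow_of_pow_eq_one (by rw [mul_pow, inv_pow, hg, hz]; simp)]
    have : g i * z⁻¹ = 1 ↔ g i = z := by
      rw [← div_eq_mul_inv, div_eq_one_iff_eq (hne z hz)]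
    simp only [this]
    split_ifs <;> ring
  have heq := (key h₁ hh₁).symm.trans (Eq.trans ?_ (key h₂ hh₂))
  · exact mul_left_cancel₀ (Nat.cast_ne_zero.2 hq.ne') heq
  · refine Finset.sum_congr rfl fun t _ => ?_
    -- Frequencies prime to p vanish by `hF`; the others see z only through z ^ p.
    by_cases ht : p ∣ t
    · obtain ⟨r, rfl⟩ := ht
      rw [pow_mul h₁⁻¹, pow_mul h₂⁻¹, inv_pow h₁, inv_pow h₂, h₁₂]
    · rw [hF t ht, zero_mul, zero_mul]

/-- Kronecker's theorem for `y - y⁻¹`, all of whose conjugates have absolute value at most one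
because they are half of some `t - t⁻¹`. -/
theorem norm_sub_inv_eq_one_of_two_mul_eq {y t : ℂ} {N : ℕ} (hN : 0 < N) (hy : y ^ N = 1)
    (ht : t ^ N = 1) (h : 2 * (y - y⁻¹) = t - t⁻¹) (hy0 : y - y⁻¹ ≠ 0) :
    ‖y - y⁻¹‖ = 1 := by
  have hζ := Complex.isPrimitiveRoot_exp N hN.ne'
  set ζ := Complex.exp (2 * Real.pi * Complex.I / N) with hζdef
  have : NeZero N := ⟨hN.ne'⟩
  obtain ⟨d, -, rfl⟩ := hζ.eq_pow_of_pow_eq_one hy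
  obtain ⟨e, -, rfl⟩ := hζ.eq_pow_of_pow_eq_one ht
  let K := IntermediateField.adjoin ℚ {ζ}
  have hζQ : IsIntegral ℚ ζ := IsIntegral.of_pow hN (hζ.pow_eq_one ▸ isIntegral_one)
  have : FiniteDimensional ℚ K := IntermediateField.adjoin.finiteDimensional hζQ
  have : NumberField K := ⟨⟩
  let z : K := ⟨ζ, IntermediateField.mem_adjoin_simple_self ℚ ζ⟩
  have hz : z ^ N = 1 := Subtype.ext (by simpa [z] using hζ.pow_eq_one)
  have hzi : IsIntegral ℤ z := IsIntegral.of_pow hN (hz ▸ isIntegral_one)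
  have hzi' : IsIntegral ℤ z⁻¹ :=
    IsIntegral.of_pow hN (by rw [inv_pow, hz, inv_one]; exact isIntegral_one)
  have hrel : (z ^ d - (z ^ d)⁻¹) + (z ^ d - (z ^ d)⁻¹) = z ^ e - (z ^ e)⁻¹ :=
    Subtype.ext (by rw [two_mul] at h; simpa [z] using h)
  rw [← two_mul] at hrel
  have hint : IsIntegral ℤ (z ^ d - (z ^ d)⁻¹) := by
    rw [← inv_pow]
    exact (hzi.pow d).sub (hzi'.pow d)
  have hne : z ^ d - (z ^ d)⁻¹ ≠ 0 := by
    intro h0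
    apply hy0
    have := congrArg (fun q : K => (q : ℂ)) h0
    simpa [z] using this
  -- The relation holds under every embedding, and there t − t⁻¹ has absolute value at most 2.
  have hle : ∀ φ : K →+* ℂ, ‖φ (z ^ d - (z ^ d)⁻¹)‖ ≤ 1 := by
    intro φ
    have h1 : φ z ^ N = 1 := by rw [← map_pow, hz, map_one]
    have h2 : ‖φ z‖ = 1 := Complex.norm_eq_one_of_pow_eq_one h1 hN.ne'
    have h3 := congrArg (fun q => ‖φ q‖) hrel
    simp only [map_mul, map_ofNat, norm_mul, RCLike.norm_ofNat] at h3
    have h4 : ‖φ (z ^ e - (z ^ e)⁻¹)‖ ≤ 2 := by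
      rw [map_sub, map_inv₀, map_pow]
      refine (norm_sub_le _ _).trans ?_
      rw [norm_inv, norm_pow, h2]
      norm_num
    linarith
  obtain ⟨r, hr, hr1⟩ := NumberField.Embeddings.pow_eq_one_of_norm_le_one K ℂ hne hint hle
  have h5 : (ζ ^ d - (ζ ^ d)⁻¹) ^ r = 1 := by
    have := congrArg (fun q : K => (q : ℂ)) hr1
    simpa [z] using this
  exact Complex.norm_eq_one_of_pow_eq_one h5 (by omega)

/-! ### Coefficients of the relation on one coset -/

/-- The coefficient at `h` of the formal sum `P [U] + P⁻¹ [U⁻¹]`. -/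
noncomputable def pairCoeff (U P h : ℂ) : ℂ :=
  (if U = h then P else 0) + (if U⁻¹ = h then P⁻¹ else 0)

/-- The coefficient at `h` of the formal sum
`A Y [X] - A⁻¹ Y [X⁻¹] - (P [U] + P⁻¹ [U⁻¹]) + (Q [V] + Q⁻¹ [V⁻¹])`. -/
noncomputable def relCoeff (X A Y U P V Q h : ℂ) : ℂ :=
  (if X = h then A * Y else 0) - (if X⁻¹ = h then A⁻¹ * Y else 0) - pairCoeff U P h
    + pairCoeff V Q h

/-- `u'` is `u` or its inverse. -/
def IsOrInv (u u' : ℂ) : Prop := u' = u ∨ u' = u⁻¹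

theorem IsOrInv.inv {u u' : ℂ} (h : IsOrInv u u') : IsOrInv u u'⁻¹ := by
  rcases h with rfl | rfl
  · exact Or.inr rfl
  · exact Or.inl (inv_inv u)

theorem IsOrInv.eq_or_mul_eq_one {u u' u'' : ℂ} (h' : IsOrInv u u') (h'' : IsOrInv u u'')
    (h0 : u ≠ 0) : u' = u'' ∨ u' * u'' = 1 := by
  rcases h' with rfl | rfl <;> rcases h'' with rfl | rfl <;> simp [h0]

theorem pairCoeff_eq_zero {U P h : ℂ} (hU : ¬ IsOrInv U h) : pairCoeff U P h = 0 := by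
  unfold IsOrInv at hU
  push Not at hU
  simp [pairCoeff, hU.1.symm, hU.2.symm]

theorem pairCoeff_isOrInv {U P h : ℂ} (hU : IsOrInv U h) (hh : h⁻¹ ≠ h) :
    IsOrInv P (pairCoeff U P h) ∧ IsOrInv (U * P) (h * pairCoeff U P h) ∧
      pairCoeff U P h⁻¹ = (pairCoeff U P h)⁻¹ := by
  unfold IsOrInv
  rcases hU with rfl | rfl
  · simp [pairCoeff, hh, hh.symm]
  · rw [inv_inv] at hh
    simp [pairCoeff, hh, hh.symm, mul_comm]

theorem relCoeff_self {X A Y U P V Q : ℂ} (hX : X⁻¹ ≠ X) :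
    relCoeff X A Y U P V Q X = A * Y - pairCoeff U P X + pairCoeff V Q X := by
  simp [relCoeff, hX]

theorem relCoeff_inv {X A Y U P V Q : ℂ} (hX : X⁻¹ ≠ X) :
    relCoeff X A Y U P V Q X⁻¹ = - (A⁻¹ * Y) - pairCoeff U P X⁻¹ + pairCoeff V Q X⁻¹ := by
  simp [relCoeff, hX.symm]

theorem isOrInv_of_relCoeff_ne_zero {X A Y U P V Q h : ℂ} (h0 : relCoeff X A Y U P V Q h ≠ 0)
    (h1 : X ≠ h) (h2 : X⁻¹ ≠ h) : IsOrInv U h ∨ IsOrInv V h := by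
  by_contra! H
  apply h0
  simp [relCoeff, h1, h2, pairCoeff_eq_zero H.1, pairCoeff_eq_zero H.2]

/-- The relation `x Y - x⁻¹ Y - (u + u⁻¹) + (v + v⁻¹) = 0` contains a shorter vanishing sum. -/
def HasShortRelation (x Y u v : ℂ) : Prop :=
  (∃ u' v', IsOrInv u u' ∧ IsOrInv v v' ∧ x * Y = u' - v') ∨
  (∃ u', IsOrInv u u' ∧ x * Y = u') ∨ (∃ v', IsOrInv v v' ∧ x * Y = -v')

/-- Multiplied by `X`, the vanishing coefficient is itself the short relation; which form it takes
depends on whether `U` and `V` meet `X` up to inversion. One of them must, since `A * Y ≠ 0`. -/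
theorem hasShortRelation_of_relCoeff_eq_zero {X A Y U P V Q : ℂ} (hX : X⁻¹ ≠ X)
    (hAY : A * Y ≠ 0) (h : relCoeff X A Y U P V Q X = 0) :
    HasShortRelation (X * A) Y (U * P) (V * Q) := by
  rw [relCoeff_self hX] at h
  by_cases hU : IsOrInv U X <;> by_cases hV : IsOrInv V X
  · refine Or.inl ⟨_, _, (pairCoeff_isOrInv hU hX).2.1, (pairCoeff_isOrInv hV hX).2.1, ?_⟩
    linear_combination X * h
  · refine Or.inr (Or.inl ⟨_, (pairCoeff_isOrInv hU hX).2.1, ?_⟩)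
    rw [pairCoeff_eq_zero hV] at h
    linear_combination X * h
  · refine Or.inr (Or.inr ⟨_, (pairCoeff_isOrInv hV hX).2.1, ?_⟩)
    rw [pairCoeff_eq_zero hU] at h
    linear_combination X * h
  · rw [pairCoeff_eq_zero hU, pairCoeff_eq_zero hV] at h
    exact absurd (by linear_combination h) hAY

/-- Without `U` and `V` the two coefficients are `A * Y` and `-A⁻¹ * Y`, which agree only if `A ^ 2
= -1`. -/
theorem isOrInv_of_relCoeff_eq_relCoeff_inv {X A Y U P V Q : ℂ} (hX : X⁻¹ ≠ X) (hA0 : A ≠ 0)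
    (hA : A ^ 2 ≠ -1) (hY : Y ≠ 0)
    (h : relCoeff X A Y U P V Q X = relCoeff X A Y U P V Q X⁻¹) :
    IsOrInv U X ∨ IsOrInv V X := by
  by_contra! H
  have hi : ∀ {W : ℂ}, ¬ IsOrInv W X → ¬ IsOrInv W X⁻¹ := fun hW h => hW (by simpa using h.inv)
  rw [relCoeff_self hX, relCoeff_inv hX, pairCoeff_eq_zero H.1, pairCoeff_eq_zero H.2,
    pairCoeff_eq_zero (hi H.1), pairCoeff_eq_zero (hi H.2)] at h
  apply hA
  have : (A + A⁻¹) * Y = 0 := by linear_combination h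
  have h2 : A + A⁻¹ = 0 := (mul_eq_zero.1 this).resolve_right hY
  field_simp at h2
  linear_combination h2

theorem isOrInv_one_iff {U : ℂ} : IsOrInv U 1 ↔ U = 1 := by
  unfold IsOrInv
  rw [eq_comm, @eq_comm _ 1 U⁻¹, inv_eq_one, or_self]

/-- The coset of 1 for p ≥ 5. A nonzero coefficient at 1 and at `X ^ 2` uses up both `U` and `V`,
leaving nothing to balance `X` against `X⁻¹`. -/
theorem relCoeff_eq_zero_of_cube_ne_one {X A Y U P V Q : ℂ} (hX0 : X ≠ 0) (hX : X⁻¹ ≠ X)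
    (hX1 : X ≠ 1) (hX3 : X ^ 3 ≠ 1) (hA0 : A ≠ 0) (hA : A ^ 2 ≠ -1) (hY : Y ≠ 0) (hV0 : V ≠ 0)
    (hU0 : U ≠ 0)
    (h1 : relCoeff X A Y U P V Q 1 = relCoeff X A Y U P V Q X)
    (h2 : relCoeff X A Y U P V Q (X ^ 2) = relCoeff X A Y U P V Q X)
    (h3 : relCoeff X A Y U P V Q X⁻¹ = relCoeff X A Y U P V Q X) :
    relCoeff X A Y U P V Q X = 0 := by
  by_contra H
  have hX2 : X ≠ X ^ 2 := fun h => hX1 (mul_left_cancel₀ hX0 (by linear_combination -h))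
  have hXi2 : X⁻¹ ≠ X ^ 2 := by
    intro h
    apply hX3
    field_simp at h
    exact h.symm
  have c1 := isOrInv_of_relCoeff_ne_zero (h1 ▸ H) hX1 (by simpa using hX1)
  have c2 := isOrInv_of_relCoeff_ne_zero (h2 ▸ H) hX2 hXi2
  have c3 := isOrInv_of_relCoeff_eq_relCoeff_inv hX hA0 hA hY h3.symm
  rw [isOrInv_one_iff, isOrInv_one_iff] at c1
  have hone : ∀ n : ℕ, X ^ n ≠ 1 → ∀ {W : ℂ}, W = 1 → ¬ IsOrInv W (X ^ n) := by
    rintro n hn W rfl (h | h)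
    · exact hn h
    · exact hn (by simpa using h)
  have hsq : X ^ 2 ≠ 1 := by
    intro h
    apply hX
    field_simp
    exact h.symm
  have hpair : ∀ {W : ℂ}, W ≠ 0 → IsOrInv W (X ^ 2) → ¬ IsOrInv W X := by
    intro W hW h h'
    rcases h.eq_or_mul_eq_one h' hW with h | h
    · exact hX2 h.symm
    · exact hX3 (by linear_combination h)
  have hX1' : X ^ 1 ≠ 1 := by simpa using hX1
  have e1 := fun {W : ℂ} => hone 1 hX1' (W := W)
  have e2 := fun {W : ℂ} => hone 2 hsq (W := W)
  simp only [pow_one] at e1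
  rcases c1 with c1 | c1
  · exact c3.elim (e1 c1) (hpair hV0 (c2.resolve_left (e2 c1)))
  · exact c3.elim (hpair hU0 (c2.resolve_right (e2 c1))) (e1 c1)

/-- The coset of 1 for p = 3. One of `U`, `V` equals 1 and the other is `X` or `X⁻¹`; comparing the
coefficients at `X` and `X⁻¹` then gives the equation to which Kronecker's theorem applies. -/
theorem exists_two_mul_eq_of_relCoeff_ne_zero {X A Y U P V Q : ℂ} (hX : X⁻¹ ≠ X)
    (hX1 : X ≠ 1) (hA0 : A ≠ 0) (hA : A ^ 2 = 1) (hY : Y ≠ 0)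
    (h1 : relCoeff X A Y U P V Q 1 = relCoeff X A Y U P V Q X)
    (h3 : relCoeff X A Y U P V Q X⁻¹ = relCoeff X A Y U P V Q X)
    (H : relCoeff X A Y U P V Q X ≠ 0) :
    ∃ t, (IsOrInv P t ∨ IsOrInv Q t) ∧ 2 * (A * Y) = t - t⁻¹ := by
  have hAi : A⁻¹ = A := by
    field_simp
    exact hA.symm
  have c1 := isOrInv_of_relCoeff_ne_zero (h1 ▸ H) hX1 (by simpa using hX1)
  have c3 := isOrInv_of_relCoeff_eq_relCoeff_inv hX hA0 (by rw [hA]; norm_num) hY h3.symm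
  rw [isOrInv_one_iff, isOrInv_one_iff] at c1
  have hone : ∀ {W : ℂ}, W = 1 → ¬ IsOrInv W X := by
    rintro W rfl (h | h)
    · exact hX1 h
    · exact hX1 (by simpa using h)
  have hone' : ∀ {W : ℂ}, W = 1 → ¬ IsOrInv W X⁻¹ := by
    intro W hW h
    exact hone hW (by simpa using h.inv)
  rw [relCoeff_self hX, relCoeff_inv hX, hAi] at h3
  rcases c1 with c1 | c1
  · obtain ⟨k1, -, k2⟩ := pairCoeff_isOrInv (P := Q) (c3.resolve_left (hone c1)) hX
    rw [pairCoeff_eq_zero (hone c1), pairCoeff_eq_zero (hone' c1), k2] at h3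
    refine ⟨_, Or.inr k1.inv, ?_⟩
    rw [inv_inv]
    linear_combination -h3
  · obtain ⟨k1, -, k2⟩ := pairCoeff_isOrInv (P := P) (c3.resolve_right (hone c1)) hX
    rw [pairCoeff_eq_zero (hone c1), pairCoeff_eq_zero (hone' c1), k2] at h3
    refine ⟨_, Or.inl k1, ?_⟩
    linear_combination -h3

/-- The relation is the one between three terms whose `p`-parts differ by `p`-th roots of unity. -/
theorem exists_eq_mul_of_isOrInv {X A Y U P V Q h₁ h₂ : ℂ} (hX0 : X ≠ 0) (hX : X⁻¹ ≠ X)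
    (hU0 : U ≠ 0) (hV0 : V ≠ 0)
    (hU : IsOrInv U h₁) (hV : IsOrInv V h₂) (hX₁ : X ≠ h₁) (hX₂ : X ≠ h₂) (h₁₂ : h₁ ≠ h₂)
    (hXX₁ : X * h₁ ≠ 1) (hXX₂ : X * h₂ ≠ 1) (hh₁₂ : h₁ * h₂ ≠ 1) (hh₁ : h₁⁻¹ ≠ h₁)
    (hh₂ : h₂⁻¹ ≠ h₂)
    (e₁ : relCoeff X A Y U P V Q h₁ = relCoeff X A Y U P V Q X)
    (e₂ : relCoeff X A Y U P V Q h₂ = relCoeff X A Y U P V Q X) :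
    ∃ u' v', IsOrInv (U * P) u' ∧ IsOrInv (V * Q) v' ∧ u' = -(h₁ * (A * Y)) ∧
      v' = h₂ * (A * Y) := by
  have no : ∀ {W g g' : ℂ}, W ≠ 0 → IsOrInv W g → g' ≠ g → g' * g ≠ 1 → ¬ IsOrInv W g' := by
    intro W g g' hW hg h1 h2 h3
    exact (h3.eq_or_mul_eq_one hg hW).elim h1 h2
  have hXi : ∀ {g : ℂ}, X * g ≠ 1 → X⁻¹ ≠ g := by
    rintro _ h rfl
    exact h (mul_inv_cancel₀ hX0)
  rw [relCoeff_self hX, pairCoeff_eq_zero (no hU0 hU hX₁ hXX₁),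
    pairCoeff_eq_zero (no hV0 hV hX₂ hXX₂)] at e₁ e₂
  rw [relCoeff, if_neg hX₁, if_neg (hXi hXX₁), pairCoeff_eq_zero (no hV0 hV h₁₂ hh₁₂)] at e₁
  rw [relCoeff, if_neg hX₂, if_neg (hXi hXX₂),
    pairCoeff_eq_zero (no hU0 hU h₁₂.symm (by rwa [mul_comm]))] at e₂
  refine ⟨_, _, (pairCoeff_isOrInv hU hh₁).2.1, (pairCoeff_isOrInv hV hh₂).2.1, ?_, ?_⟩
  · linear_combination -h₁ * e₁
  · linear_combination h₂ * e₂

/-- The exceptional form of the relation, with three terms `x Y`, `u'` and `v'` whose quotients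
are sixth roots of unity. -/
def HasSextileRelation (Y u v : ℂ) : Prop :=
  ‖Y‖ = 1 ∧ ∃ u' v', IsOrInv u u' ∧ IsOrInv v v' ∧ u' / v' + v' / u' = 1

theorem IsOrInv.norm_eq_one {u u' : ℂ} (h : IsOrInv u u') (hu : ‖u‖ = 1) : ‖u'‖ = 1 := by
  rcases h with rfl | rfl <;> simp [hu]

/-- The coefficient at `X` vanishes, or the relation is exceptional, when `X ^ p ≠ 1`. -/
theorem relCoeff_eq_zero_or_hasSextileRelation {p : ℕ} (hp : p.Prime) (hp3 : 3 ≤ p)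
    {X A Y U P V Q : ℂ} (hX0 : X ≠ 0)
    (hXp : X ^ (2 * p) ≠ 1) (hU0 : U ≠ 0) (hV0 : V ≠ 0) (hnX : ‖X‖ = 1) (hnA : ‖A‖ = 1)
    (hnU : ‖U * P‖ = 1)
    (hc : ∀ h, h ^ p = X ^ p → relCoeff X A Y U P V Q h = relCoeff X A Y U P V Q X) :
    relCoeff X A Y U P V Q X = 0 ∨ HasSextileRelation Y (U * P) (V * Q) := by
  by_contra! H
  obtain ⟨H, H'⟩ := H
  obtain ⟨ω, hω⟩ : ∃ ω : ℂ, IsPrimitiveRoot ω p := ⟨_, Complex.isPrimitiveRoot_exp p hp.ne_zero⟩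
  have hω0 : ω ≠ 0 := hω.ne_zero hp.ne_zero
  have hcos : ∀ k : ℕ, (X * ω ^ k) ^ p = X ^ p := fun k => by
    rw [mul_pow, ← pow_mul, mul_comm k, pow_mul, hω.pow_eq_one, one_pow, mul_one]
  -- Since `X ^ (2 * p) ≠ 1`, the coset of `X` is disjoint from its inverse, so `U` and `V` each
  -- meet it at most once.
  have hne : ∀ k l : ℕ, X * ω ^ k * (X * ω ^ l) ≠ 1 := by
    intro k l h
    apply hXp
    have := congrArg (· ^ p) h
    simp only [mul_pow _ _ p, one_pow] at this
    rw [← mul_pow, ← mul_pow, hcos, hcos] at this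
    rw [← this]; ring
  have hinj : ∀ k l : ℕ, k < p → l < p → k ≠ l → X * ω ^ k ≠ X * ω ^ l := by
    intro k l hk hl hkl h
    exact hkl (hω.pow_inj hk hl (mul_left_cancel₀ hX0 h))
  have hself : ∀ k, (X * ω ^ k)⁻¹ ≠ X * ω ^ k := by
    intro k h
    refine hne k k ?_
    nth_rewrite 1 [← h]
    exact inv_mul_cancel₀ (mul_ne_zero hX0 (pow_ne_zero _ hω0))
  have hX : X⁻¹ ≠ X := by simpa using hself 0
  have hXk : ∀ k, X * (X * ω ^ k) ≠ 1 := fun k => by simpa using hne 0 k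
  have hXne : ∀ k, 0 < k → k < p → X ≠ X * ω ^ k := fun k hk hkp => by
    simpa using hinj 0 k hp.pos hkp hk.ne
  have hmem : ∀ k, 0 < k → k < p → IsOrInv U (X * ω ^ k) ∨ IsOrInv V (X * ω ^ k) := by
    intro k hk hkp
    refine isOrInv_of_relCoeff_ne_zero (by rw [hc _ (hcos k)]; exact H) (hXne k hk hkp) ?_
    intro h
    exact hXk k (by rw [← h, mul_inv_cancel₀ hX0])
  have hpair : ∀ {W : ℂ}, W ≠ 0 → ∀ k l, k < p → l < p → k ≠ l → IsOrInv W (X * ω ^ k) →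
      ¬ IsOrInv W (X * ω ^ l) := by
    intro W hW k l hk hl hkl h h'
    exact (h.eq_or_mul_eq_one h' hW).elim (hinj k l hk hl hkl) (hne k l)
  rcases hp3.eq_or_lt with hp3 | hp3
  · subst hp3
    have hsum : ω ^ 2 + ω + 1 = 0 := by
      have h1 : (ω - 1) * (ω ^ 2 + ω + 1) = 0 := by linear_combination hω.pow_eq_one
      exact (mul_eq_zero.1 h1).resolve_left (sub_ne_zero.2 (hω.ne_one (by norm_num)))
    have main : ∀ k l : ℕ, 0 < k → k < 3 → 0 < l → l < 3 → k ≠ l → ω ^ k / ω ^ l + ω ^ l / ω ^ k = -1 →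
        IsOrInv U (X * ω ^ k) → IsOrInv V (X * ω ^ l) → False := by
      intro k l hk hk3 hl hl3 hkl hsum' hU hV
      obtain ⟨u', v', hu', hv', eu, ev⟩ := exists_eq_mul_of_isOrInv hX0 hX hU0 hV0 hU hV
        (hXne k hk hk3) (hXne l hl hl3) (hinj k l hk3 hl3 hkl) (hXk k) (hXk l) (hne k l)
        (hself k) (hself l) (hc _ (hcos k)) (hc _ (hcos l))
      have hn : ‖u'‖ = 1 := hu'.norm_eq_one hnU
      have hY : ‖Y‖ = 1 := by
        rw [eu, norm_neg, norm_mul, norm_mul, norm_mul, hnX, hnA, norm_pow,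
          Complex.norm_eq_one_of_pow_eq_one hω.pow_eq_one (by norm_num)] at hn
        simpa using hn
      refine H' ⟨hY, u', v', hu', hv', ?_⟩
      have hA0 : A ≠ 0 := by rintro rfl; simp at hnA
      have hY0 : Y ≠ 0 := by rintro rfl; simp at hY
      have q1 : u' / v' = -(ω ^ k / ω ^ l) := by
        rw [eu, ev]; field_simp
      have q2 : v' / u' = -(ω ^ l / ω ^ k) := by
        rw [eu, ev]; field_simp
      rw [q1, q2]
      linear_combination -hsum'
    have s12 : ω ^ 1 / ω ^ 2 + ω ^ 2 / ω ^ 1 = -1 := by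
      field_simp
      linear_combination hsum
    rcases hmem 1 (by norm_num) (by norm_num) with h1 | h1
    · have h2 := (hmem 2 (by norm_num) (by norm_num)).resolve_left
        (hpair hU0 1 2 (by norm_num) (by norm_num) (by norm_num) h1)
      exact main 1 2 (by norm_num) (by norm_num) (by norm_num) (by norm_num) (by norm_num) s12 h1 h2
    · have h2 := (hmem 2 (by norm_num) (by norm_num)).resolve_right
        (hpair hV0 1 2 (by norm_num) (by norm_num) (by norm_num) h1)
      exact main 2 1 (by norm_num) (by norm_num) (by norm_num) (by norm_num) (by norm_num)
        (by rw [add_comm]; exact s12) h2 h1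
  -- For p > 3 three further points of the coset would have to be covered by `U` and `V`, one each.
  · have m1 := hmem 1 (by norm_num) (by omega)
    have m2 := hmem 2 (by norm_num) (by omega)
    have m3 := hmem 3 (by norm_num) hp3
    have pU := fun k l hk hl hkl => hpair hU0 k l hk hl hkl
    have pV := fun k l hk hl hkl => hpair hV0 k l hk hl hkl
    have u12 := pU 1 2 (by omega) (by omega) (by omega)
    have u13 := pU 1 3 (by omega) (by omega) (by omega)
    have u23 := pU 2 3 (by omega) (by omega) (by omega)
    have v12 := pV 1 2 (by omega) (by omega) (by omega)
    have v13 := pV 1 3 (by omega) (by omega) (by omega)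
    have v23 := pV 2 3 (by omega) (by omega) (by omega)
    rcases m1 with k1 | k1 <;> rcases m2 with k2 | k2 <;> rcases m3 with k3 | k3 <;>
      first
      | exact u12 k1 k2
      | exact u13 k1 k3
      | exact u23 k2 k3
      | exact v12 k1 k2
      | exact v13 k1 k3
      | exact v23 k2 k3

/-! ### Splitting off p-parts and the classification of the vanishing sums -/

/-- Exponents which project a root of unity to its components of order prime to `p` and of
`p`-power order. -/
theorem exists_primary_exponents {q M : ℕ} (h : Nat.Coprime q M) :
    ∃ e₁ e₂ : ℕ, q ∣ e₁ ∧ M ∣ e₂ ∧ e₁ + e₂ ≡ 1 [MOD q * M] := by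
  obtain ⟨e₁, h1, h2⟩ := Nat.chineseRemainder h 0 1
  obtain ⟨e₂, h3, h4⟩ := Nat.chineseRemainder h 1 0
  refine ⟨e₁, e₂, (Nat.modEq_zero_iff_dvd).1 h1, (Nat.modEq_zero_iff_dvd).1 h4, ?_⟩
  rw [← Nat.modEq_and_modEq_iff_modEq_mul h]
  exact ⟨by simpa using h1.add h3, by simpa using h2.add h4⟩

/-- Splitting off the `p`-parts of the terms of the relation makes its coefficients constant on
the cosets of the group of `p`-th roots of unity. -/
theorem relCoeff_eq_of_pow_eq {p n M : ℕ} (hp : p.Prime) (hM : 0 < M) (hpM : ¬ p ∣ M)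
    {X A y U P V Q : ℂ} (hX : X ^ p ^ n = 1) (hU : U ^ p ^ n = 1) (hV : V ^ p ^ n = 1)
    (hA : A ^ M = 1) (hy : y ^ M = 1) (hP : P ^ M = 1) (hQ : Q ^ M = 1)
    (h : X * A * (y - y⁻¹) - (X * A)⁻¹ * (y - y⁻¹) - (U * P + (U * P)⁻¹)
      + (V * Q + (V * Q)⁻¹) = 0) {h₁ h₂ : ℂ} (hh₁ : h₁ ^ p ^ n = 1)
    (hh₂ : h₂ ^ p ^ n = 1) (h₁₂ : h₁ ^ p = h₂ ^ p) :
    relCoeff X A (y - y⁻¹) U P V Q h₁ = relCoeff X A (y - y⁻¹) U P V Q h₂ := by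
  have key := sum_ite_eq_of_pow_eq (Finset.univ : Finset (Fin 8)) hp hM hpM (n := n)
    ![1, -1, -1, 1, -1, -1, 1, 1]
    ![A * y, A * y⁻¹, A⁻¹ * y, A⁻¹ * y⁻¹, P, P⁻¹, Q, Q⁻¹]
    ![X, X, X⁻¹, X⁻¹, U, U⁻¹, V, V⁻¹]
    (by
      intro i
      fin_cases i <;> simp [mul_pow, hA, hy, hP, hQ])
    (by
      intro i
      fin_cases i <;> simp [hX, hU, hV])
    (by
      rw [← h]
      simp [Fin.sum_univ_eight]
      ring) hh₁ hh₂ h₁₂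
  have expand : ∀ g : ℂ, ∑ i : Fin 8, (if (![X, X, X⁻¹, X⁻¹, U, U⁻¹, V, V⁻¹] : Fin 8 → ℂ) i = g then
      (((![1, -1, -1, 1, -1, -1, 1, 1] : Fin 8 → ℤ) i : ℤ) : ℂ) *
        (![A * y, A * y⁻¹, A⁻¹ * y, A⁻¹ * y⁻¹, P, P⁻¹, Q, Q⁻¹] : Fin 8 → ℂ) i else 0) =
      relCoeff X A (y - y⁻¹) U P V Q g := by
    intro g
    have hite : ∀ (c : Prop) [Decidable c] (s t : ℂ),
        (if c then s * (y - y⁻¹) else t) = if c then s * y - s * y⁻¹ else t := by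
      intro c _ s t
      rw [mul_sub]
    simp only [relCoeff, pairCoeff, Fin.sum_univ_eight, hite]
    simp
    split_ifs <;> ring
  rwa [expand, expand] at key

/-- If a root of unity `y` satisfies `‖y - y⁻¹‖ = 1`, then three divides its order. -/
theorem norm_sub_inv_ne_one {b : ℕ} (hb : 0 < b) (hb3 : ¬ 3 ∣ b) {y : ℂ} (hy : y ^ (2 * b) = 1) :
    ‖y - y⁻¹‖ ≠ 1 := by
  intro h
  have hn : ‖y‖ = 1 := Complex.norm_eq_one_of_pow_eq_one hy (by omega)
  have hy0 : y ≠ 0 := by rintro rfl; simp at hn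
  have hconj : (starRingEnd ℂ) y = y⁻¹ := (Complex.inv_eq_conj hn).symm
  have h1 : (y - y⁻¹) * (starRingEnd ℂ) (y - y⁻¹) = 1 := by
    rw [Complex.mul_conj, Complex.normSq_eq_norm_sq, h]; simp
  rw [map_sub, map_inv₀, hconj, inv_inv] at h1
  -- This is the twelfth cyclotomic polynomial at `y`.
  have h2 : y ^ 4 - y ^ 2 + 1 = 0 := by
    field_simp at h1
    linear_combination -h1
  have h12 : y ^ 12 = 1 := by
    linear_combination (y ^ 8 + y ^ 6 - y ^ 2 - 1) * h2
  have hd : orderOf y ∣ 4 := by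
    have d1 : orderOf y ∣ 3 * 4 := orderOf_dvd_of_pow_eq_one h12
    have d2 := orderOf_dvd_of_pow_eq_one hy
    refine Nat.Coprime.dvd_of_dvd_mul_left ?_ d1
    refine Nat.Coprime.coprime_dvd_left d2 ?_
    rw [Nat.coprime_comm, Nat.Prime.coprime_iff_not_dvd Nat.prime_three,
      Nat.Prime.dvd_mul Nat.prime_three]
    omega
  have h4 : y ^ 4 = 1 := orderOf_dvd_iff_pow_eq_one.1 hd
  have h5 : y ^ 2 = 2 := by linear_combination h4 - h2
  have h6 := congrArg norm h5
  rw [norm_pow, hn] at h6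
  norm_num at h6

theorem eq_one_of_pow_eq_one_of_coprime {z : ℂ} {m n : ℕ} (h : Nat.Coprime m n) (hm : z ^ m = 1)
    (hn : z ^ n = 1) : z = 1 := by
  have := Nat.dvd_gcd (orderOf_dvd_of_pow_eq_one hm) (orderOf_dvd_of_pow_eq_one hn)
  rw [h, Nat.dvd_one] at this
  exact orderOf_eq_one_iff.1 this

/-- The vanishing sums of the roots of unity `± (x y) ^ ± 1`, `± (x / y) ^ ± 1`, `± u ^ ± 1`,
`± v ^ ± 1`, where `x ^ 2` and `y ^ 2` have coprime orders and that of `x ^ 2` is odd. -/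
theorem hasShortRelation_or_hasSextileRelation {a b N : ℕ} (hab : Nat.Coprime a b) (ha : Odd a)
    (hb : 0 < b) (hN : 0 < N) {x y u v : ℂ} (hx : x ^ (2 * a) = 1) (hx2 : x ^ 2 ≠ 1)
    (hy : y ^ (2 * b) = 1) (hy2 : y ^ 2 ≠ 1) (hu : u ^ N = 1) (hv : v ^ N = 1)
    (h : x * (y - y⁻¹) - x⁻¹ * (y - y⁻¹) - (u + u⁻¹) + (v + v⁻¹) = 0) :
    HasShortRelation x (y - y⁻¹) u v ∨ HasSextileRelation (y - y⁻¹) u v := by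
  have ha0 : 0 < a := ha.pos
  have hord : orderOf (x ^ 2) ∣ a := orderOf_dvd_of_pow_eq_one (by rw [← pow_mul, hx])
  have hord1 : orderOf (x ^ 2) ≠ 1 := fun h => hx2 (orderOf_eq_one_iff.1 h)
  -- The prime 3 is taken only when no other divides the order; this later forces `A ^ 2 = 1`.
  obtain ⟨p, hp, hpo, hp5⟩ : ∃ p : ℕ, p.Prime ∧ p ∣ orderOf (x ^ 2) ∧
      (p = 3 → ∃ k, orderOf (x ^ 2) = 3 ^ k) := by
    by_cases H : ∃ p : ℕ, p.Prime ∧ p ∣ orderOf (x ^ 2) ∧ p ≠ 3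
    · obtain ⟨p, h1, h2, h3⟩ := H
      exact ⟨p, h1, h2, fun h => absurd h h3⟩
    · push Not at H
      obtain ⟨p, h1, h2⟩ := Nat.exists_prime_and_dvd hord1
      refine ⟨p, h1, h2, fun _ => ⟨_, Nat.eq_prime_pow_of_unique_prime_dvd
        (fun h0 => ?_) (fun {d} hd hd' => H d hd hd')⟩⟩
      rw [h0, zero_dvd_iff] at hord
      omega
  have hpa : p ∣ a := hpo.trans hord
  have hp2 : p ≠ 2 := by
    rintro rfl
    exact (Nat.not_even_iff_odd.2 ha) (even_iff_two_dvd.2 hpa)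
  have hp3 : 3 ≤ p := by
    have := hp.two_le
    omega
  have hpodd : Odd p := hp.odd_of_ne_two hp2
  have hpb : ¬ p ∣ b := fun h => hp.one_lt.ne' (Nat.dvd_one.1 (hab ▸ Nat.dvd_gcd hpa h))
  have hL : 2 * a * b * N ≠ 0 := by positivity
  obtain ⟨n, M, hpM, hnM⟩ := Nat.exists_eq_pow_mul_and_not_dvd hL p hp.ne_one
  have hM : 0 < M := by
    rcases Nat.eq_zero_or_pos M with rfl | h
    · simp at hpM
    · exact h
  have hcop : Nat.Coprime (p ^ n) M :=
    Nat.Coprime.pow_left n ((Nat.Prime.coprime_iff_not_dvd hp).2 hpM)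
  obtain ⟨e₁, e₂, ⟨d₁, hd₁⟩, ⟨d₂, hd₂⟩, he⟩ := exists_primary_exponents hcop
  have hsplit : ∀ {z : ℂ}, z ^ (2 * a * b * N) = 1 →
      (z ^ e₂) ^ p ^ n = 1 ∧ (z ^ e₁) ^ M = 1 ∧ z ^ e₂ * z ^ e₁ = z := by
    intro z hz
    rw [hnM] at hz
    refine ⟨?_, ?_, ?_⟩
    · rw [hd₂, ← pow_mul, show M * d₂ * p ^ n = p ^ n * M * d₂ by ring, pow_mul, hz, one_pow]
    · rw [hd₁, ← pow_mul, show p ^ n * d₁ * M = p ^ n * M * d₁ by ring, pow_mul, hz, one_pow]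
    · rw [← pow_add, add_comm, pow_eq_pow_of_modEq he hz, pow_one]
  obtain ⟨hXp, hAM, hxe⟩ := hsplit (z := x) (by rw [mul_assoc, pow_mul, hx, one_pow])
  obtain ⟨hUp, hPM, hue⟩ := hsplit (z := u) (by rw [mul_comm, pow_mul, hu, one_pow])
  obtain ⟨hVp, hQM, hve⟩ := hsplit (z := v) (by rw [mul_comm, pow_mul, hv, one_pow])
  have hyM : y ^ M = 1 := by
    have h1 : 2 * b ∣ p ^ n * M := by
      rw [← hnM]
      exact ⟨a * N, by ring⟩
    have h2 : Nat.Coprime (2 * b) (p ^ n) := by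
      refine Nat.Coprime.pow_right n ?_
      rw [Nat.coprime_comm, Nat.Prime.coprime_iff_not_dvd hp, hp.dvd_mul, not_or]
      exact ⟨fun h => hp2 ((Nat.prime_dvd_prime_iff_eq hp Nat.prime_two).1 h), hpb⟩
    obtain ⟨r, hr⟩ := h2.dvd_of_dvd_mul_left h1
    rw [hr, pow_mul, hy, one_pow]
  have hA2a : ((x ^ e₁) ^ 2) ^ orderOf (x ^ 2) = 1 := by
    rw [pow_right_comm x e₁ 2, pow_right_comm (x ^ 2) e₁, pow_orderOf_eq_one, one_pow]
  -- Otherwise the order of `x` would divide `M`, although p divides the order of `x ^ 2`.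
  have hX1 : x ^ e₂ ≠ 1 := by
    intro hX
    rw [hX, one_mul] at hxe
    rw [hxe] at hAM
    exact hpM (hpo.trans (orderOf_dvd_of_pow_eq_one (by rw [pow_right_comm, hAM, one_pow])))
  generalize x ^ e₂ = X at *
  generalize x ^ e₁ = A at *
  generalize u ^ e₂ = U at *
  generalize u ^ e₁ = P at *
  generalize v ^ e₂ = V at *
  generalize v ^ e₁ = Q at *
  have hq0 : p ^ n ≠ 0 := pow_ne_zero _ hp.ne_zero
  have hne : ∀ {z : ℂ} {r : ℕ}, r ≠ 0 → z ^ r = 1 → z ≠ 0 := by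
    rintro z r hr hz rfl
    rw [zero_pow hr] at hz
    exact zero_ne_one hz
  have hX0 := hne hq0 hXp
  have hU0 := hne hq0 hUp
  have hV0 := hne hq0 hVp
  have hA0 := hne hM.ne' hAM
  have hy0 := hne hM.ne' hyM
  have hY : y - y⁻¹ ≠ 0 := by
    intro h0
    apply hy2
    field_simp at h0
    linear_combination h0
  have hqodd : Nat.Coprime 2 (p ^ n) := (Nat.coprime_two_left).2 hpodd.pow
  have hXi : X⁻¹ ≠ X := by
    intro h0
    refine hX1 (eq_one_of_pow_eq_one_of_coprime hqodd ?_ hXp)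
    field_simp at h0
    exact h0.symm
  have hA2 : A ^ 2 ≠ -1 := by
    intro h0
    rw [h0, (Odd.of_dvd_nat ha hord).neg_one_pow] at hA2a
    norm_num at hA2a
  have hn0 : n ≠ 0 := by
    rintro rfl
    exact hX1 (by simpa using hXp)
  have hpn : ∀ {z : ℂ}, z ^ p = 1 → z ^ p ^ n = 1 := by
    intro z hz
    obtain ⟨r, hr⟩ := dvd_pow_self p hn0
    rw [hr, pow_mul, hz, one_pow]
  subst hxe hue hve
  have hc : ∀ g, g ^ p = X ^ p → relCoeff X A (y - y⁻¹) U P V Q g =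
      relCoeff X A (y - y⁻¹) U P V Q X := by
    intro g hg
    refine relCoeff_eq_of_pow_eq hp hM hpM hXp hUp hVp hAM hyM hPM hQM h ?_ hXp hg
    obtain ⟨r, hr⟩ := dvd_pow_self p hn0
    rw [hr, pow_mul, hg, ← pow_mul, ← hr, hXp]
  suffices hs : relCoeff X A (y - y⁻¹) U P V Q X = 0 ∨
      HasSextileRelation (y - y⁻¹) (U * P) (V * Q) from
    hs.imp_left (hasShortRelation_of_relCoeff_eq_zero hXi (mul_ne_zero hA0 hY))
  by_cases hXpp : X ^ p = 1
  · left
    have c1 := hc 1 (by rw [one_pow, hXpp])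
    have c2 := hc (X ^ 2) (by rw [pow_right_comm, hXpp, one_pow])
    have c3 := hc X⁻¹ (by rw [inv_pow, hXpp, inv_one])
    by_cases hp3 : p = 3
    · subst hp3
      by_contra H
      obtain ⟨k, hk⟩ := hp5 rfl
      have hA1 : A ^ 2 = 1 := by
        rw [hk] at hA2a
        refine eq_one_of_pow_eq_one_of_coprime (m := 3 ^ k) (n := M) ?_ hA2a
          (by rw [pow_right_comm, hAM, one_pow])
        exact Nat.Coprime.pow_left k ((Nat.Prime.coprime_iff_not_dvd hp).2 hpM)
      obtain ⟨t, ht, hte⟩ := exists_two_mul_eq_of_relCoeff_ne_zero hXi hX1 hA0 hA1 hY c1 c3 H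
      have htM : t ^ M = 1 := by
        rcases ht with (rfl | rfl) | (rfl | rfl) <;> simp [hPM, hQM]
      have hAi : A⁻¹ = A := by
        field_simp
        exact hA1.symm
      -- As A = ±1, it can be absorbed into t. The resulting ‖y − y⁻¹‖ = 1 would force 3 to divide
      -- b.
      refine norm_sub_inv_ne_one hb hpb hy (norm_sub_inv_eq_one_of_two_mul_eq hM hyM
        (t := A * t) (by rw [mul_pow, hAM, htM, one_mul]) ?_ hY)
      rw [mul_inv, hAi]
      linear_combination A * hte - 2 * (y - y⁻¹) * hA1
    · refine relCoeff_eq_zero_of_cube_ne_one hX0 hXi hX1 (fun h3 => hX1 ?_) hA0 hA2 hY hV0 hU0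
        c1 c2 c3
      exact eq_one_of_pow_eq_one_of_coprime
        ((Nat.coprime_primes Nat.prime_three hp).2 (Ne.symm hp3)) h3 hXpp
  · refine relCoeff_eq_zero_or_hasSextileRelation hp hp3 hX0 (fun h2 => hXpp ?_) hU0 hV0
      (Complex.norm_eq_one_of_pow_eq_one hXp hq0) (Complex.norm_eq_one_of_pow_eq_one hAM hM.ne')
      (Complex.norm_eq_one_of_pow_eq_one hu hN.ne') hc
    refine eq_one_of_pow_eq_one_of_coprime hqodd (by rw [← pow_mul, mul_comm, h2]) ?_
    rw [pow_right_comm, hXp, one_pow]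

/-! ### Points of the unit circle -/

/-- The point of the unit circle with argument `θ`. -/
noncomputable def unitPt (θ : ℝ) : ℂ := Complex.exp (θ * Complex.I)

theorem unitPt_eq (θ : ℝ) : unitPt θ = Real.cos θ + Real.sin θ * Complex.I := by
  rw [unitPt, Complex.exp_mul_I, Complex.ofReal_cos, Complex.ofReal_sin]

theorem unitPt_re (θ : ℝ) : (unitPt θ).re = Real.cos θ := Complex.exp_ofReal_mul_I_re θ

theorem unitPt_add (θ ψ : ℝ) : unitPt (θ + ψ) = unitPt θ * unitPt ψ := by
  rw [unitPt, unitPt, unitPt, ← Complex.exp_add]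
  push_cast
  ring_nf

theorem unitPt_neg (θ : ℝ) : unitPt (-θ) = (unitPt θ)⁻¹ := by
  rw [unitPt, unitPt, ← Complex.exp_neg]
  push_cast
  ring_nf

theorem unitPt_sub (θ ψ : ℝ) : unitPt (θ - ψ) = unitPt θ / unitPt ψ := by
  rw [sub_eq_add_neg, unitPt_add, unitPt_neg, div_eq_mul_inv]

theorem unitPt_ne_zero (θ : ℝ) : unitPt θ ≠ 0 := Complex.exp_ne_zero _

theorem norm_unitPt (θ : ℝ) : ‖unitPt θ‖ = 1 := Complex.norm_exp_ofReal_mul_I θ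

theorem unitPt_sub_inv (θ : ℝ) : unitPt θ - (unitPt θ)⁻¹ = 2 * Real.sin θ * Complex.I := by
  rw [← unitPt_neg, unitPt_eq, unitPt_eq, Real.cos_neg, Real.sin_neg]
  push_cast
  ring

theorem unitPt_add_inv (θ : ℝ) : unitPt θ + (unitPt θ)⁻¹ = 2 * Real.cos θ := by
  rw [← unitPt_neg, unitPt_eq, unitPt_eq, Real.cos_neg, Real.sin_neg]
  push_cast
  ring

theorem unitPt_pow_eq_one {k c : ℕ} (hc : 0 < c) :
    unitPt ((k : ℝ) * Real.pi / c) ^ (2 * c) = 1 := by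
  rw [unitPt, ← Complex.exp_nat_mul, Complex.exp_eq_one_iff]
  have : (c : ℂ) ≠ 0 := Nat.cast_ne_zero.2 hc.ne'
  refine ⟨k, ?_⟩
  push_cast
  field_simp

theorem isOrInv_unitPt {θ : ℝ} {u : ℂ} (h : IsOrInv (unitPt θ) u) :
    ∃ θ', u = unitPt θ' ∧ (θ' = θ ∨ θ' = -θ) := by
  rcases h with rfl | rfl
  · exact ⟨θ, rfl, Or.inl rfl⟩
  · exact ⟨-θ, (unitPt_neg θ).symm, Or.inr rfl⟩

theorem unitPt_sq_ne_one {θ : ℝ} (h : Real.sin θ ≠ 0) : unitPt θ ^ 2 ≠ 1 := by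
  intro h1
  have h2 := unitPt_sub_inv θ
  have h3 : unitPt θ - (unitPt θ)⁻¹ = 0 := by
    have := unitPt_ne_zero θ
    field_simp
    linear_combination h1
  rw [h3] at h2
  have : (Real.sin θ : ℂ) ≠ 0 := Complex.ofReal_ne_zero.2 h
  simp_all

/-- Two pairs of points of the unit circle with the same nonzero sum coincide. -/
theorem eq_or_eq_of_add_eq_add {p q r s : ℂ} (hp : ‖p‖ = 1) (hq : ‖q‖ = 1) (hr : ‖r‖ = 1)
    (hs : ‖s‖ = 1) (h : p + q = r + s) : (p = r ∧ q = s) ∨ (p = s ∧ q = r) ∨ p + q = 0 := by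
  by_cases h0 : p + q = 0
  · exact Or.inr (Or.inr h0)
  have hne : ∀ {z : ℂ}, ‖z‖ = 1 → z ≠ 0 := by
    rintro z hz rfl
    simp at hz
  have hp0 := hne hp
  have hq0 := hne hq
  have hr0 := hne hr
  have hs0 := hne hs
  have hconj := congrArg (starRingEnd ℂ) h
  rw [map_add, map_add, ← Complex.inv_eq_conj hp, ← Complex.inv_eq_conj hq,
    ← Complex.inv_eq_conj hr, ← Complex.inv_eq_conj hs] at hconj
  -- Conjugation inverts unit vectors, so the sums of reciprocals agree too, and with them the
  -- products.
  have hmul : p * q = r * s := by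
    field_simp at hconj
    refine mul_left_cancel₀ h0 ?_
    linear_combination -hconj + p * q * h
  have hfac : (p - r) * (p - s) = 0 := by linear_combination p * h - hmul
  rcases mul_eq_zero.1 hfac with h1 | h1
  · left
    exact ⟨sub_eq_zero.1 h1, by linear_combination h - h1⟩
  · right; left
    exact ⟨sub_eq_zero.1 h1, by linear_combination h - h1⟩

theorem sin_eq_sin_of_cos_two_mul_eq {θ ψ : ℝ} (hθ : 0 < Real.sin θ) (hψ : 0 < Real.sin ψ)
    (h : Real.cos (2 * θ) = Real.cos (2 * ψ)) : Real.sin θ = Real.sin ψ := by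
  rw [Real.cos_two_mul, Real.cos_two_mul, Real.cos_sq', Real.cos_sq'] at h
  have : Real.sin θ ^ 2 = Real.sin ψ ^ 2 := by linarith
  exact (pow_left_inj₀ hθ.le hψ.le (by norm_num)).1 this

/-- The half-sum and half-difference of `± (γ₁ + γ₂)` and `± (γ₁ - γ₂)` are `γ₁` and `γ₂`, up to
order and signs. -/
theorem cos_add_cos_sub_eq {γ₁ γ₂ θ ψ : ℝ} (hθ : θ = γ₁ + γ₂ ∨ θ = -(γ₁ + γ₂))
    (hψ : ψ = γ₁ - γ₂ ∨ ψ = -(γ₁ - γ₂)) :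
    (Real.cos (θ + ψ) = Real.cos (2 * γ₁) ∧ Real.cos (θ - ψ) = Real.cos (2 * γ₂)) ∨
    (Real.cos (θ + ψ) = Real.cos (2 * γ₂) ∧ Real.cos (θ - ψ) = Real.cos (2 * γ₁)) := by
  rcases hθ with rfl | rfl <;> rcases hψ with rfl | rfl
  · left; constructor <;> ring_nf
  · right; constructor <;> ring_nf
  · right
    rw [← Real.cos_neg (2 * γ₂), ← Real.cos_neg (2 * γ₁)]
    constructor <;> ring_nf
  · left
    rw [← Real.cos_neg (2 * γ₂), ← Real.cos_neg (2 * γ₁)]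
    constructor <;> ring_nf

theorem eq_pi_div_six_or_of_sin_eq_half {β : ℝ} (h0 : 0 < β) (h1 : β < Real.pi)
    (h : Real.sin β = 1 / 2) : β = Real.pi / 6 ∨ β = 5 * Real.pi / 6 := by
  have hpi := Real.pi_pos
  rcases le_total β (Real.pi / 2) with hle | hle
  · left
    refine Real.injOn_sin ⟨by linarith, hle⟩ ⟨by linarith, by linarith⟩ ?_
    rw [h, Real.sin_pi_div_six]
  · right
    have : Real.pi - β = Real.pi / 6 := by
      refine Real.injOn_sin ⟨by linarith, by linarith⟩ ⟨by linarith, by linarith⟩ ?_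
      rw [Real.sin_pi_sub, h, Real.sin_pi_div_six]
    linarith

/-! ### Products of two sines of rational angles -/

section Classification

variable {α β γ₁ γ₂ : ℝ}

/-- Rearranged, the relation equates two sums of two unit vectors. The vectors match in pairs or
both sums vanish; each possibility determines cos(θ + ψ) and cos(θ − ψ), hence the sines. -/
theorem sineCase_of_eq_sub (hα : 0 < Real.sin α) (hβ : 0 < Real.sin β) (h₁ : 0 < Real.sin γ₁)
    (h₂ : 0 < Real.sin γ₂) {θ ψ : ℝ} (hθ : θ = γ₁ + γ₂ ∨ θ = -(γ₁ + γ₂))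
    (hψ : ψ = γ₁ - γ₂ ∨ ψ = -(γ₁ - γ₂))
    (h : unitPt α * (unitPt β - (unitPt β)⁻¹) = unitPt θ - unitPt ψ) : SineCase α β γ₁ γ₂ := by
  have h' : unitPt (α + β) + unitPt ψ = unitPt θ + unitPt (α - β) := by
    rw [unitPt_add, unitPt_sub, div_eq_mul_inv]
    linear_combination h
  have hcos : Real.cos (θ + ψ) = Real.cos (2 * α) ∧ Real.cos (θ - ψ) = Real.cos (2 * β) := by
    rcases eq_or_eq_of_add_eq_add (norm_unitPt _) (norm_unitPt _) (norm_unitPt _) (norm_unitPt _)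
      h' with ⟨e1, e2⟩ | ⟨e1, -⟩ | e
    · constructor
      · rw [← unitPt_re, unitPt_add, ← e1, e2, ← unitPt_add, unitPt_re]
        ring_nf
      · rw [← unitPt_re, unitPt_sub, ← e1, e2, ← unitPt_sub, unitPt_re]
        ring_nf
    · exfalso
      apply unitPt_sq_ne_one hβ.ne'
      rw [unitPt_add, unitPt_sub, div_eq_mul_inv] at e1
      have e2 := mul_left_cancel₀ (unitPt_ne_zero α) e1
      have := unitPt_ne_zero β
      field_simp at e2
      exact e2
    · have e1 : unitPt ψ = -unitPt (α + β) := by linear_combination e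
      have e2 : unitPt θ = -unitPt (α - β) := by linear_combination -h' + e
      constructor
      · rw [← unitPt_re, unitPt_add, e1, e2, neg_mul_neg, ← unitPt_add, unitPt_re]
        ring_nf
      · rw [← unitPt_re, unitPt_sub, e1, e2, neg_div_neg_eq, ← unitPt_sub, unitPt_re,
          ← Real.cos_neg]
        ring_nf
  rcases cos_add_cos_sub_eq hθ hψ with ⟨k1, k2⟩ | ⟨k1, k2⟩ <;>
    rw [hcos.1] at k1 <;> rw [hcos.2] at k2
  · exact Or.inl ⟨sin_eq_sin_of_cos_two_mul_eq hα h₁ k1, sin_eq_sin_of_cos_two_mul_eq hβ h₂ k2⟩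
  · exact Or.inr ⟨sin_eq_sin_of_cos_two_mul_eq hα h₂ k1, sin_eq_sin_of_cos_two_mul_eq hβ h₁ k2⟩

theorem norm_unitPt_sub_inv (hβ : 0 < Real.sin β) :
    ‖unitPt β - (unitPt β)⁻¹‖ = 2 * Real.sin β := by
  rw [unitPt_sub_inv, norm_mul, norm_mul, Complex.norm_I, Complex.norm_real, Real.norm_eq_abs,
    abs_of_pos hβ]
  simp

theorem re_unitPt_mul_sub_inv (α β : ℝ) :
    (unitPt α * (unitPt β - (unitPt β)⁻¹)).re = -(2 * (Real.sin α * Real.sin β)) := by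
  rw [unitPt_sub_inv, unitPt_eq]
  simp [-Complex.ofReal_sin, -Complex.ofReal_cos]
  ring

/-- The norm condition says sin β = 1/2, and the quotient condition gives cos 2γ = 1/2 for one of
γ₁, γ₂. That γ has the same sine as β, and the product identity supplies the other equality. -/
theorem sineCase_of_hasSextileRelation (hβ : 0 < Real.sin β) (h₁ : 0 < Real.sin γ₁)
    (h₂ : 0 < Real.sin γ₂) (hprod : Real.sin γ₁ * Real.sin γ₂ = Real.sin α * Real.sin β)
    (h : HasSextileRelation (unitPt β - (unitPt β)⁻¹) (unitPt (γ₁ + γ₂)) (unitPt (γ₁ - γ₂))) :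
    SineCase α β γ₁ γ₂ := by
  obtain ⟨hn, u, v, hu, hv, huv⟩ := h
  rw [norm_unitPt_sub_inv hβ] at hn
  obtain ⟨θ, rfl, hθ⟩ := isOrInv_unitPt hu
  obtain ⟨ψ, rfl, hψ⟩ := isOrInv_unitPt hv
  rw [← inv_div (unitPt θ), ← unitPt_sub, unitPt_add_inv] at huv
  have hcos : Real.cos (θ - ψ) = 1 / 2 := by
    have : 2 * Real.cos (θ - ψ) = 1 := by exact_mod_cast huv
    linarith
  have half : ∀ γ, 0 < Real.sin γ → Real.cos (2 * γ) = 1 / 2 → Real.sin γ = Real.sin β := by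
    intro γ hγ h
    rw [Real.cos_two_mul, Real.cos_sq'] at h
    refine (pow_left_inj₀ hγ.le hβ.le (n := 2) (by norm_num)).1 ?_
    have : Real.sin β = 1 / 2 := by linarith
    rw [this]
    linarith
  rcases cos_add_cos_sub_eq hθ hψ with ⟨-, k⟩ | ⟨-, k⟩
  · have e := half γ₂ h₂ (by rw [← k, hcos])
    rw [e] at hprod
    exact Or.inl ⟨(mul_right_cancel₀ hβ.ne' hprod).symm, e.symm⟩
  · have e := half γ₁ h₁ (by rw [← k, hcos])
    rw [e, mul_comm] at hprod
    exact Or.inr ⟨(mul_right_cancel₀ hβ.ne' hprod).symm, e.symm⟩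

theorem two_mul_sin_mul_sin_eq (γ₁ γ₂ : ℝ) :
    2 * (Real.sin γ₁ * Real.sin γ₂) = Real.cos (γ₁ - γ₂) - Real.cos (γ₁ + γ₂) := by
  rw [Real.cos_sub, Real.cos_add]
  ring

/-- Products of two sines of rational angles: the classification of the solutions of
`sin γ₁ * sin γ₂ = sin α * sin β` where `α / π` and `β / π` have coprime denominators and that
of `α / π` is odd. -/
theorem sineCase_or_sixthCase {a b c i j k₁ k₂ : ℕ} (hab : Nat.Coprime a b) (ha : Odd a)
    (hb : 0 < b) (hc : 0 < c) (hα0 : 0 < α) (hα2 : α < Real.pi / 2) (hβ0 : 0 < β)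
    (hβ1 : β < Real.pi) (h₁0 : 0 < γ₁) (h₁2 : γ₁ ≤ Real.pi / 2) (h₂0 : 0 < γ₂)
    (h₂2 : γ₂ ≤ Real.pi / 2)
    (hα : α = (i : ℝ) * Real.pi / (a : ℝ)) (hβ : β = (j : ℝ) * Real.pi / (b : ℝ))
    (hγ₁ : γ₁ = (k₁ : ℝ) * Real.pi / (c : ℝ)) (hγ₂ : γ₂ = (k₂ : ℝ) * Real.pi / (c : ℝ))
    (hprod : Real.sin γ₁ * Real.sin γ₂ = Real.sin α * Real.sin β) :
    SineCase α β γ₁ γ₂ ∨ SixthCase α β γ₁ γ₂ := by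
  have hpi := Real.pi_pos
  have sα : 0 < Real.sin α := Real.sin_pos_of_pos_of_lt_pi hα0 (by linarith)
  have sβ : 0 < Real.sin β := Real.sin_pos_of_pos_of_lt_pi hβ0 hβ1
  have s₁ : 0 < Real.sin γ₁ := Real.sin_pos_of_pos_of_lt_pi h₁0 (by linarith)
  have s₂ : 0 < Real.sin γ₂ := Real.sin_pos_of_pos_of_lt_pi h₂0 (by linarith)
  have hp₁ : unitPt γ₁ ^ (2 * c) = 1 := hγ₁ ▸ unitPt_pow_eq_one hc
  have hp₂ : unitPt γ₂ ^ (2 * c) = 1 := hγ₂ ▸ unitPt_pow_eq_one hc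
  have hdiff := two_mul_sin_mul_sin_eq γ₁ γ₂
  have hrel : unitPt α * (unitPt β - (unitPt β)⁻¹) - (unitPt α)⁻¹ * (unitPt β - (unitPt β)⁻¹)
      - (unitPt (γ₁ + γ₂) + (unitPt (γ₁ + γ₂))⁻¹) + (unitPt (γ₁ - γ₂) + (unitPt (γ₁ - γ₂))⁻¹)
      = 0 := by
    rw [← sub_mul, unitPt_sub_inv, unitPt_sub_inv, unitPt_add_inv, unitPt_add_inv]
    have e : (2 : ℂ) * (Real.sin α * Real.sin β) = Real.cos (γ₁ - γ₂) - Real.cos (γ₁ + γ₂) := by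
      rw [hprod] at hdiff
      exact_mod_cast hdiff
    linear_combination 4 * Real.sin α * Real.sin β * Complex.I_sq - 2 * e
  rcases hasShortRelation_or_hasSextileRelation hab ha hb (N := 2 * c) (by omega)
    (hα ▸ unitPt_pow_eq_one ha.pos) (unitPt_sq_ne_one sα.ne') (hβ ▸ unitPt_pow_eq_one hb)
    (unitPt_sq_ne_one sβ.ne') (by rw [unitPt_add, mul_pow, hp₁, hp₂, one_mul])
    (by rw [unitPt_sub, div_pow, hp₁, hp₂, div_one]) hrel with
    (⟨u, v, hu, hv, huv⟩ | ⟨u, hu, he⟩ | ⟨v, hv, he⟩) | hs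
  · obtain ⟨θ, rfl, hθ⟩ := isOrInv_unitPt hu
    obtain ⟨ψ, rfl, hψ⟩ := isOrInv_unitPt hv
    exact Or.inl (sineCase_of_eq_sub sα sβ s₁ s₂ hθ hψ huv)
  -- Real parts would give cos(γ₁ − γ₂) = 0, but |γ₁ − γ₂| < π/2.
  · exfalso
    obtain ⟨θ, rfl, hθ⟩ := isOrInv_unitPt hu
    have hcos : Real.cos θ = Real.cos (γ₁ + γ₂) := by
      rcases hθ with rfl | rfl
      · rfl
      · exact Real.cos_neg _
    have hre := congrArg Complex.re he
    rw [re_unitPt_mul_sub_inv, unitPt_re, hcos] at hre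
    have : 0 < Real.cos (γ₁ - γ₂) :=
      Real.cos_pos_of_mem_Ioo ⟨by linarith, by linarith⟩
    linarith
  -- The norm gives sin β = 1/2, and the real part gives cos(γ₁ + γ₂) = 0.
  · right
    have hn := congrArg norm he
    obtain ⟨ψ, rfl, hψ⟩ := isOrInv_unitPt hv
    rw [norm_mul, norm_neg, norm_unitPt, norm_unitPt, one_mul, norm_unitPt_sub_inv sβ] at hn
    have hcos : Real.cos ψ = Real.cos (γ₁ - γ₂) := by
      rcases hψ with rfl | rfl
      · rfl
      · exact Real.cos_neg _
    have hre := congrArg Complex.re he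
    rw [re_unitPt_mul_sub_inv, Complex.neg_re, unitPt_re, hcos] at hre
    have hsum : γ₁ + γ₂ = Real.pi / 2 := by
      refine Real.injOn_cos ⟨by linarith, by linarith⟩ ⟨by linarith, by linarith⟩ ?_
      rw [Real.cos_pi_div_two]
      linarith
    refine ⟨eq_pi_div_six_or_of_sin_eq_half hβ0 hβ1 (by linarith), ?_⟩
    have hs2 : Real.sin (2 * γ₁) = Real.sin α := by
      rw [Real.sin_two_mul]
      have : γ₂ = Real.pi / 2 - γ₁ := by linarith
      rw [this, Real.sin_pi_div_two_sub] at hprod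
      have hh : Real.sin β = 1 / 2 := by linarith
      rw [hh] at hprod
      linarith
    rcases le_total (2 * γ₁) (Real.pi / 2) with hle | hle
    · left
      have : 2 * γ₁ = α :=
        Real.injOn_sin ⟨by linarith, hle⟩ ⟨by linarith, by linarith⟩ hs2
      constructor <;> linarith
    · right
      have : Real.pi - 2 * γ₁ = α :=
        Real.injOn_sin ⟨by linarith, by linarith⟩ ⟨by linarith, by linarith⟩
          (by rw [Real.sin_pi_sub, hs2])
      constructor <;> linarith
  · exact Or.inl (sineCase_of_hasSextileRelation sβ s₁ s₂ hprod hs)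

end Classification

/-! ### Common roots of the polynomials -/

theorem aeval_factorPoly_pi_div_two (α β : ℝ) (φ : ℂ) :
    Polynomial.aeval φ (factorPoly α β (Real.pi / 2)) =
      φ + 2 * Real.cos α * Real.cos β := by
  rw [factorPoly, if_pos rfl]
  simp

/-- This form exposes the symmetry s ↔ sin α sin β / s, where s = sin γ. -/
theorem factorPoly_constantCoeff_eq {α β γ : ℝ} (hγ : Real.sin γ ≠ 0) :
    4 * ((Real.cos α ^ 2 - Real.cos γ ^ 2) * (Real.cos β ^ 2 - Real.cos γ ^ 2)) / Real.sin γ ^ 2 =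
      4 * (Real.sin γ ^ 2 + (Real.sin α * Real.sin β / Real.sin γ) ^ 2
        - Real.sin α ^ 2 - Real.sin β ^ 2) := by
  rw [Real.cos_sq', Real.cos_sq', Real.cos_sq']
  field_simp
  ring

theorem factorPoly_of_ne {α β γ : ℝ} (hγ : Real.sin γ ≠ 0) (h : γ ≠ Real.pi / 2) :
    factorPoly α β γ = Polynomial.X ^ 2
      + Polynomial.C (4 * Real.cos α * Real.cos β) * Polynomial.X
      + Polynomial.C (4 * (Real.sin γ ^ 2 + (Real.sin α * Real.sin β / Real.sin γ) ^ 2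
        - Real.sin α ^ 2 - Real.sin β ^ 2)) := by
  rw [factorPoly, if_neg h, factorPoly_constantCoeff_eq hγ]

theorem aeval_factorPoly_of_ne {α β γ : ℝ} (hγ : Real.sin γ ≠ 0) (h : γ ≠ Real.pi / 2) (φ : ℂ) :
    Polynomial.aeval φ (factorPoly α β γ) = φ ^ 2 + 4 * Real.cos α * Real.cos β * φ
      + ((4 * (Real.sin γ ^ 2 + (Real.sin α * Real.sin β / Real.sin γ) ^ 2
        - Real.sin α ^ 2 - Real.sin β ^ 2) : ℝ) : ℂ) := by
  rw [factorPoly_of_ne hγ h]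
  simp

theorem IsCommonRoot.symm {P Q : ℝ[X]} {φ : ℂ} (h : IsCommonRoot P Q φ) : IsCommonRoot Q P φ :=
  ⟨h.2, h.1⟩

theorem isCommonRoot_comm {P Q : ℝ[X]} {φ : ℂ} : IsCommonRoot P Q φ ↔ IsCommonRoot Q P φ :=
  ⟨IsCommonRoot.symm, IsCommonRoot.symm⟩

/-- The difference of the two sides is a multiple of (s² − t²)((st)² − r²). -/
theorem eq_of_add_div_sq_eq {s t r : ℝ} (hs : 0 < s) (ht : 0 < t) (hr : 0 < r) (hst : s ≠ t)
    (h : s ^ 2 + (r / s) ^ 2 = t ^ 2 + (r / t) ^ 2) : s * t = r := by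
  have hsq : s ^ 2 - t ^ 2 ≠ 0 := by
    intro h0
    exact hst ((pow_left_inj₀ hs.le ht.le (n := 2) (by norm_num)).1 (by linarith))
  have h1 : (s ^ 2 - t ^ 2) * ((s * t) ^ 2 - r ^ 2) = 0 := by
    field_simp at h
    linear_combination h
  have h2 := (mul_eq_zero.1 h1).resolve_left hsq
  exact (pow_left_inj₀ (mul_pos hs ht).le hr.le (n := 2) (by norm_num)).1 (by linarith)

section

variable {α β γ₁ γ₂ : ℝ}

/-- Substituting the root −2 cos α cos β makes the constant term 4 cos²α cos²β, its value for sine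
1. So `eq_of_add_div_sq_eq` applies with t = 1. -/
theorem sin_mul_sin_eq_of_isCommonRoot_pi_div_two (hr : 0 < Real.sin α * Real.sin β)
    (h₂0 : 0 < γ₂) (h₂2 : γ₂ ≤ Real.pi / 2) (hne : Real.pi / 2 ≠ γ₂) {φ : ℂ}
    (h : IsCommonRoot (factorPoly α β (Real.pi / 2)) (factorPoly α β γ₂) φ) :
    Real.sin γ₂ = Real.sin α * Real.sin β := by
  have hpi := Real.pi_pos
  have s₂ : 0 < Real.sin γ₂ := Real.sin_pos_of_pos_of_lt_pi h₂0 (by linarith)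
  obtain ⟨h1, h2⟩ := h
  rw [aeval_factorPoly_pi_div_two] at h1
  rw [aeval_factorPoly_of_ne s₂.ne' hne.symm] at h2
  have e : φ = -(2 * Real.cos α * Real.cos β) := by linear_combination h1
  have e2 : 4 * (Real.sin γ₂ ^ 2 + (Real.sin α * Real.sin β / Real.sin γ₂) ^ 2
        - Real.sin α ^ 2 - Real.sin β ^ 2) = 4 * (Real.cos α ^ 2 * Real.cos β ^ 2) := by
    rw [e] at h2
    have : ((4 * (Real.sin γ₂ ^ 2 + (Real.sin α * Real.sin β / Real.sin γ₂) ^ 2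
        - Real.sin α ^ 2 - Real.sin β ^ 2) : ℝ) : ℂ) =
        ((4 * (Real.cos α ^ 2 * Real.cos β ^ 2) : ℝ) : ℂ) := by
      rw [Complex.ofReal_mul 4 (Real.cos α ^ 2 * Real.cos β ^ 2),
        Complex.ofReal_mul (Real.cos α ^ 2),
        Complex.ofReal_pow, Complex.ofReal_pow, Complex.ofReal_ofNat]
      linear_combination h2
    exact_mod_cast this
  rw [Real.cos_sq', Real.cos_sq'] at e2
  have hs1 : Real.sin γ₂ ≠ 1 := by
    intro h
    refine hne (Real.injOn_sin ⟨by linarith, le_rfl⟩ ⟨by linarith, h₂2⟩ ?_)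
    rw [h, Real.sin_pi_div_two]
  have := eq_of_add_div_sq_eq s₂ one_pos hr hs1 (by rw [div_one]; linarith)
  rwa [mul_one] at this

theorem sin_mul_sin_eq_of_isCommonRoot (hr : 0 < Real.sin α * Real.sin β)
    (h₁0 : 0 < γ₁) (h₁2 : γ₁ ≤ Real.pi / 2)
    (h₂0 : 0 < γ₂) (h₂2 : γ₂ ≤ Real.pi / 2) (hne : γ₁ ≠ γ₂) {φ : ℂ}
    (h : IsCommonRoot (factorPoly α β γ₁) (factorPoly α β γ₂) φ) :
    Real.sin γ₁ * Real.sin γ₂ = Real.sin α * Real.sin β := by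
  have hpi := Real.pi_pos
  have s₁ : 0 < Real.sin γ₁ := Real.sin_pos_of_pos_of_lt_pi h₁0 (by linarith)
  have s₂ : 0 < Real.sin γ₂ := Real.sin_pos_of_pos_of_lt_pi h₂0 (by linarith)
  by_cases e₁ : γ₁ = Real.pi / 2
  · subst e₁
    rw [sin_mul_sin_eq_of_isCommonRoot_pi_div_two hr h₂0 h₂2 hne h, Real.sin_pi_div_two, one_mul]
  by_cases e₂ : γ₂ = Real.pi / 2
  · subst e₂
    rw [sin_mul_sin_eq_of_isCommonRoot_pi_div_two hr h₁0 h₁2 hne.symm h.symm,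
      Real.sin_pi_div_two, mul_one]
  obtain ⟨h1, h2⟩ := h
  rw [aeval_factorPoly_of_ne s₁.ne' e₁] at h1
  rw [aeval_factorPoly_of_ne s₂.ne' e₂] at h2
  have h3 := Complex.ofReal_injective (add_left_cancel (h1.trans h2.symm))
  refine eq_of_add_div_sq_eq s₁ s₂ hr (fun hs => hne ?_) (by linarith)
  exact Real.injOn_sin ⟨by linarith, h₁2⟩ ⟨by linarith, h₂2⟩ hs

theorem factorPoly_eq_of_sin_mul_sin_eq (s₁ : Real.sin γ₁ ≠ 0) (s₂ : Real.sin γ₂ ≠ 0)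
    (e₁ : γ₁ ≠ Real.pi / 2) (e₂ : γ₂ ≠ Real.pi / 2)
    (h : Real.sin γ₁ * Real.sin γ₂ = Real.sin α * Real.sin β) :
    factorPoly α β γ₁ = factorPoly α β γ₂ := by
  rw [factorPoly_of_ne s₁ e₁, factorPoly_of_ne s₂ e₂, ← h, mul_div_cancel_left₀ _ s₁,
    mul_div_cancel_right₀ _ s₂, add_comm (Real.sin γ₁ ^ 2)]

/-- Each equality of sines kills one factor of a constant term, leaving φ(φ + 4 cos α cos β). If γ₂
= π/2 then cos β = 0 and both roots collapse to 0. -/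
theorem isCommonRoot_iff_of_sin_eq (hα0 : 0 < α) (hα2 : α < Real.pi / 2)
    (hβ : 0 < Real.sin β) (h₁0 : 0 < γ₁)
    (h₁2 : γ₁ ≤ Real.pi / 2) (h₂0 : 0 < γ₂) (h₂2 : γ₂ ≤ Real.pi / 2)
    (h₁ : Real.sin α = Real.sin γ₁) (h₂ : Real.sin β = Real.sin γ₂) (φ : ℂ) :
    IsCommonRoot (factorPoly α β γ₁) (factorPoly α β γ₂) φ ↔
      φ = 0 ∨ φ = ((-4 * Real.cos α * Real.cos β : ℝ) : ℂ) := by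
  have hpi := Real.pi_pos
  have hαγ : α = γ₁ :=
    Real.injOn_sin ⟨by linarith, by linarith⟩ ⟨by linarith, h₁2⟩ h₁
  subst hαγ
  have sα : 0 < Real.sin α := Real.sin_pos_of_pos_of_lt_pi hα0 (by linarith)
  have root : ∀ {K : ℂ}, K = 0 → (φ ^ 2 + 4 * Real.cos α * Real.cos β * φ + K = 0 ↔
      φ = 0 ∨ φ = ((-4 * Real.cos α * Real.cos β : ℝ) : ℂ)) := by
    rintro K rfl
    have hfac : φ ^ 2 + 4 * Real.cos α * Real.cos β * φ + 0 =
        φ * (φ - ((-4 * Real.cos α * Real.cos β : ℝ) : ℂ)) := by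
      rw [Complex.ofReal_mul, Complex.ofReal_mul, Complex.ofReal_neg, Complex.ofReal_ofNat]
      ring
    rw [hfac, mul_eq_zero, sub_eq_zero]
  have r₁ := root (K := ((4 * (Real.sin α ^ 2 + (Real.sin α * Real.sin β / Real.sin α) ^ 2
        - Real.sin α ^ 2 - Real.sin β ^ 2) : ℝ) : ℂ)) (by
    rw [mul_div_cancel_left₀ _ sα.ne', Complex.ofReal_eq_zero]; ring)
  rw [IsCommonRoot, aeval_factorPoly_of_ne sα.ne' hα2.ne, r₁]
  by_cases e₂ : γ₂ = Real.pi / 2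
  · subst e₂
    rw [Real.sin_pi_div_two] at h₂
    have hc : Real.cos β = 0 := by
      have := Real.sin_sq_add_cos_sq β
      rw [h₂] at this
      nlinarith
    rw [aeval_factorPoly_pi_div_two, hc]
    simp
  · have s₂ : 0 < Real.sin γ₂ := h₂ ▸ hβ
    rw [aeval_factorPoly_of_ne s₂.ne' e₂, root (by
      rw [h₂, mul_div_cancel_right₀ _ s₂.ne', Complex.ofReal_eq_zero]; ring), and_self]

/-- Here sin γ₂ = cos γ₁, so sin γ₁ sin γ₂ = (sin α)/2 and the two quadratics coincide; their roots
are read off from sum and product. -/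
theorem isCommonRoot_iff_of_half (hα0 : 0 < α) (hα2 : α < Real.pi / 2)
    (hβ : Real.sin β = 1 / 2) (h₁ : γ₁ = α / 2) (h₂ : γ₂ = Real.pi / 2 - α / 2) (φ : ℂ) :
    IsCommonRoot (factorPoly α β γ₁) (factorPoly α β γ₂) φ ↔
      φ = ((-2 * Real.cos (α + β) : ℝ) : ℂ) ∨ φ = ((-2 * Real.cos (α - β) : ℝ) : ℂ) := by
  have hpi := Real.pi_pos
  have s₁ : 0 < Real.sin γ₁ := Real.sin_pos_of_pos_of_lt_pi (by linarith) (by linarith)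
  have s₂ : 0 < Real.sin γ₂ := Real.sin_pos_of_pos_of_lt_pi (by linarith) (by linarith)
  have hcos : Real.sin γ₂ = Real.cos γ₁ := by rw [h₂, h₁, Real.sin_pi_div_two_sub]
  have hprod : Real.sin γ₁ * Real.sin γ₂ = Real.sin α * Real.sin β := by
    have : Real.sin α = 2 * Real.sin γ₁ * Real.cos γ₁ := by
      rw [← Real.sin_two_mul, h₁]
      ring_nf
    rw [hcos, this, hβ]
    ring
  have e₁ : γ₁ ≠ Real.pi / 2 := by
    intro h
    linarith
  have e₂ : γ₂ ≠ Real.pi / 2 := by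
    intro h
    linarith
  rw [← factorPoly_eq_of_sin_mul_sin_eq s₁.ne' s₂.ne' e₁ e₂ hprod, IsCommonRoot, and_self,
    aeval_factorPoly_of_ne s₁.ne' e₁, ← hprod, mul_div_cancel_left₀ _ s₁.ne', hcos,
    Real.sin_sq_add_cos_sq, hβ]
  have key : 4 * (1 - Real.sin α ^ 2 - (1 / 2) ^ 2) =
      (-2 * Real.cos (α + β)) * (-2 * Real.cos (α - β)) := by
    rw [Real.cos_add, Real.cos_sub, hβ]
    have h1 := Real.sin_sq_add_cos_sq α
    have h2 := Real.sin_sq_add_cos_sq β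
    rw [hβ] at h2
    linear_combination -3 * h1 - 4 * Real.cos α ^ 2 * h2
  have sum : 4 * Real.cos α * Real.cos β =
      -((-2 * Real.cos (α + β)) + (-2 * Real.cos (α - β))) := by
    rw [Real.cos_add, Real.cos_sub]
    ring
  have sum' : (4 : ℂ) * Real.cos α * Real.cos β =
      -(((-2 * Real.cos (α + β) : ℝ) : ℂ) + ((-2 * Real.cos (α - β) : ℝ) : ℂ)) := by
    exact_mod_cast congrArg (fun r : ℝ => (r : ℂ)) sum
  rw [key, sum', Complex.ofReal_mul (-2 * Real.cos (α + β))]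
  generalize ((-2 * Real.cos (α + β) : ℝ) : ℂ) = r
  generalize ((-2 * Real.cos (α - β) : ℝ) : ℂ) = s
  rw [show φ ^ 2 + -(r + s) * φ + r * s = (φ - r) * (φ - s) by ring, mul_eq_zero, sub_eq_zero,
    sub_eq_zero]

theorem eq_pi_div_two_of_sineCase (hα0 : 0 < α) (hα2 : α < Real.pi / 2) (hβ0 : 0 < β)
    (hβ1 : β < Real.pi) (h₂0 : 0 < γ₂) (h₂2 : γ₂ ≤ Real.pi / 2)
    (h : SineCase α β (Real.pi / 2) γ₂) : β = Real.pi / 2 ∧ γ₂ = α := by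
  have hpi := Real.pi_pos
  rw [SineCase, Real.sin_pi_div_two] at h
  rcases h with ⟨h, -⟩ | ⟨h1, h2⟩
  · exfalso
    refine hα2.ne (Real.injOn_sin ⟨by linarith, hα2.le⟩ ⟨by linarith, le_rfl⟩ ?_)
    rw [h, Real.sin_pi_div_two]
  · refine ⟨?_, (Real.injOn_sin ⟨by linarith, hα2.le⟩ ⟨by linarith, h₂2⟩ h1).symm⟩
    refine Real.injOn_cos ⟨hβ0.le, hβ1.le⟩ ⟨by linarith, by linarith⟩ ?_
    have := Real.sin_sq_add_cos_sq β
    rw [h2] at this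
    rw [Real.cos_pi_div_two]
    nlinarith

theorem SineCase.symm (h : SineCase α β γ₁ γ₂) : SineCase α β γ₂ γ₁ := Or.symm h

end

/-! ### Assembly of the classification -/

theorem mainTheorem12 (a b c i j k₁ k₂ : ℕ) (hab : Nat.Coprime a b) (ha : Odd a)
    (hi : 1 ≤ i) (hia : 2 * i < a) (hj : 1 ≤ j) (hjb : j < b)
    (hk₁ : 1 ≤ k₁) (hk₁c : 2 * k₁ ≤ c) (hk₂ : 1 ≤ k₂) (hk₂c : 2 * k₂ ≤ c)
    (α β γ₁ γ₂ : ℝ)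
    (hα : α = (i : ℝ) * Real.pi / (a : ℝ)) (hβ : β = (j : ℝ) * Real.pi / (b : ℝ))
    (hγ₁ : γ₁ = (k₁ : ℝ) * Real.pi / (c : ℝ)) (hγ₂ : γ₂ = (k₂ : ℝ) * Real.pi / (c : ℝ))
    (hne : γ₁ ≠ γ₂) :
    ((∃ φ : ℂ, IsCommonRoot (factorPoly α β γ₁) (factorPoly α β γ₂) φ) ↔
      (factorPoly α β γ₁ = factorPoly α β γ₂ ∨
        (β = Real.pi / 2 ∧
          ((γ₁ = Real.pi / 2 ∧ γ₂ = α) ∨ (γ₂ = Real.pi / 2 ∧ γ₁ = α)))) ∧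
      (SineCase α β γ₁ γ₂ ∨ SixthCase α β γ₁ γ₂)) ∧
    (SineCase α β γ₁ γ₂ →
      ∀ φ : ℂ, IsCommonRoot (factorPoly α β γ₁) (factorPoly α β γ₂) φ ↔
        φ = 0 ∨ φ = ((-4 * Real.cos α * Real.cos β : ℝ) : ℂ)) ∧
    (SixthCase α β γ₁ γ₂ →
      ∀ φ : ℂ, IsCommonRoot (factorPoly α β γ₁) (factorPoly α β γ₂) φ ↔
        φ = ((-2 * Real.cos (α + β) : ℝ) : ℂ) ∨ φ = ((-2 * Real.cos (α - β) : ℝ) : ℂ)) := by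
  have hpi := Real.pi_pos
  have pos : ∀ {k c : ℕ}, 1 ≤ k → k ≤ c → 0 < (k : ℝ) * Real.pi / (c : ℝ) := by
    intro k c hk hc
    have : (0 : ℝ) < k := by exact_mod_cast hk
    have : (0 : ℝ) < c := by exact_mod_cast hk.trans hc
    positivity
  have le_half : ∀ {k c : ℕ}, 1 ≤ k → 2 * k ≤ c → (k : ℝ) * Real.pi / (c : ℝ) ≤ Real.pi / 2 := by
    intro k c hk hc
    have h1 : (0 : ℝ) < c := by exact_mod_cast (by omega : 0 < c)
    have h2 : (2 : ℝ) * k ≤ c := by exact_mod_cast hc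
    rw [div_le_div_iff₀ h1 two_pos]
    nlinarith
  have hα0 : 0 < α := hα ▸ pos hi (by omega)
  have hβ0 : 0 < β := hβ ▸ pos hj hjb.le
  have h₁0 : 0 < γ₁ := hγ₁ ▸ pos hk₁ (by omega)
  have h₂0 : 0 < γ₂ := hγ₂ ▸ pos hk₂ (by omega)
  have h₁2 : γ₁ ≤ Real.pi / 2 := hγ₁ ▸ le_half hk₁ hk₁c
  have h₂2 : γ₂ ≤ Real.pi / 2 := hγ₂ ▸ le_half hk₂ hk₂c
  have hα2 : α < Real.pi / 2 := by
    have h1 : (0 : ℝ) < a := by exact_mod_cast (by omega : 0 < a)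
    have h2 : (2 : ℝ) * i < a := by exact_mod_cast hia
    rw [hα, div_lt_div_iff₀ h1 two_pos]
    nlinarith
  have hβ1 : β < Real.pi := by
    have h1 : (0 : ℝ) < b := by exact_mod_cast (by omega : 0 < b)
    have h2 : (j : ℝ) < b := by exact_mod_cast hjb
    rw [hβ, div_lt_iff₀ h1]
    nlinarith
  have sα : 0 < Real.sin α := Real.sin_pos_of_pos_of_lt_pi hα0 (by linarith)
  have sβ : 0 < Real.sin β := Real.sin_pos_of_pos_of_lt_pi hβ0 hβ1
  have s₁ : 0 < Real.sin γ₁ := Real.sin_pos_of_pos_of_lt_pi h₁0 (by linarith)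
  have s₂ : 0 < Real.sin γ₂ := Real.sin_pos_of_pos_of_lt_pi h₂0 (by linarith)
  have sineRoots : SineCase α β γ₁ γ₂ →
      ∀ φ : ℂ, IsCommonRoot (factorPoly α β γ₁) (factorPoly α β γ₂) φ ↔
        φ = 0 ∨ φ = ((-4 * Real.cos α * Real.cos β : ℝ) : ℂ) := by
    rintro (⟨h1, h2⟩ | ⟨h1, h2⟩) φ
    · exact isCommonRoot_iff_of_sin_eq hα0 hα2 sβ h₁0 h₁2 h₂0 h₂2 h1 h2 φ
    · rw [isCommonRoot_comm]
      exact isCommonRoot_iff_of_sin_eq hα0 hα2 sβ h₂0 h₂2 h₁0 h₁2 h1 h2 φ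
  have sixthRoots : SixthCase α β γ₁ γ₂ →
      ∀ φ : ℂ, IsCommonRoot (factorPoly α β γ₁) (factorPoly α β γ₂) φ ↔
        φ = ((-2 * Real.cos (α + β) : ℝ) : ℂ) ∨ φ = ((-2 * Real.cos (α - β) : ℝ) : ℂ) := by
    rintro ⟨hβ6, h⟩ φ
    have hs : Real.sin β = 1 / 2 := by
      rcases hβ6 with h | h
      · rw [h, Real.sin_pi_div_six]
      · rw [h, show 5 * Real.pi / 6 = Real.pi - Real.pi / 6 by ring, Real.sin_pi_sub,
          Real.sin_pi_div_six]
    rcases h with ⟨h1, h2⟩ | ⟨h1, h2⟩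
    · exact isCommonRoot_iff_of_half hα0 hα2 hs h1 h2 φ
    · rw [isCommonRoot_comm]
      exact isCommonRoot_iff_of_half hα0 hα2 hs h1 h2 φ
  refine ⟨⟨?_, ?_⟩, sineRoots, sixthRoots⟩
  · rintro ⟨φ, hφ⟩
    have hprod := sin_mul_sin_eq_of_isCommonRoot (mul_pos sα sβ) h₁0 h₁2 h₂0 h₂2 hne hφ
    have hcase := sineCase_or_sixthCase hab ha (by omega) (by omega) hα0 hα2 hβ0 hβ1 h₁0 h₁2
      h₂0 h₂2 hα hβ hγ₁ hγ₂ hprod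
    refine ⟨?_, hcase⟩
    by_cases e₁ : γ₁ = Real.pi / 2
    · right
      rcases hcase with h | ⟨-, h⟩
      · obtain ⟨k1, k2⟩ := eq_pi_div_two_of_sineCase hα0 hα2 hβ0 hβ1 h₂0 h₂2 (e₁ ▸ h)
        exact ⟨k1, Or.inl ⟨e₁, k2⟩⟩
      · rcases h with ⟨k1, k2⟩ | ⟨k1, k2⟩ <;> exfalso <;> linarith
    by_cases e₂ : γ₂ = Real.pi / 2
    · right
      rcases hcase with h | ⟨-, h⟩
      · obtain ⟨k1, k2⟩ := eq_pi_div_two_of_sineCase hα0 hα2 hβ0 hβ1 h₁0 h₁2 (e₂ ▸ h.symm)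
        exact ⟨k1, Or.inr ⟨e₂, k2⟩⟩
      · rcases h with ⟨k1, k2⟩ | ⟨k1, k2⟩ <;> exfalso <;> linarith
    exact Or.inl (factorPoly_eq_of_sin_mul_sin_eq s₁.ne' s₂.ne' e₁ e₂ hprod)
  -- Either case already exhibits a root, so the first condition is a consequence of the second.
  · rintro ⟨-, h | h⟩
    · exact ⟨0, (sineRoots h 0).2 (Or.inl rfl)⟩
    · exact ⟨_, (sixthRoots h _).2 (Or.inl rfl)⟩
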